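/- Let $\Omega\subset\mathbb{R}^3$ be a bounded open set with $C^1$ boundary (near each boundary point $p$ there are an open set $U\ni p$ and a $C^1$ function $\rho$ on $U$ with $\nabla\rho\neq0$ and $\Omega\cap U=\{x\in U:\rho(x)<0\}$) and strictly positive curvature, in the sense that for every $p\in\partial\Omega$, with outward unit normal $\nu$ at $p$, there is $c>0$ such that $\langle \nu,y-p\rangle\le -c|y-p|^2$ for all $y\in\Omega$ close to $p$ (for a $C^2$ boundary: all principal curvatures with respect to the outward normal, signed so that those of balls are positive, are strictly positive). Let $D=\operatorname{diam}(\Omega)$, let $dn$ be the surface measure on $\mathbb{S}^2$, let $(\varphi_j)_{j\in\mathbb{N}}$ and $(\psi_j)_{j\in\mathbb{N}}$ be bounded sequences in $L^\infty(\Omega)$, extended by $0$ to $\mathbb{R}^3$, and let $f\in L^\infty(\mathbb{S}^2)$ be non-negative. For $x\in\mathbb{R}^3$, $n\in\mathbb{S}^2$, $r\ge0$ put $$E_j(x,n,r)=\exp\Big(-\int_0^r\psi_j(x-\lambda n)\,d\lambda\Big),\qquad A_j(x,n,r)=\varphi_j(x-rn)\,E_j(x,n,r).$$ Then, for all $j$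 and $x\in\mathbb{R}^3$, $\lambda\mapsto\psi_j(x-\lambda n)$ and $r\mapsto A_j(x,n,r)$ are integrable on $[0,D]$ for almost every $n\in\mathbb{S}^2$, the functions $n\mapsto\int_0^DA_j(x,n,r)\,dr$ and $n\mapsto f(n)E_j(x,n,D)$ are integrable on $\mathbb{S}^2$, and the two sequences $$x\mapsto\int_{\mathbb{S}^2}dn\int_0^D dr\,A_j(x,n,r)\qquad\text{and}\qquad x\mapsto\int_{\mathbb{S}^2}dn\,f(n)\,E_j(x,n,D)$$ lie in $L^2(\Omega)$ and are compact there (each of the two sets of functions is relatively compact in $L^2(\Omega)$). Moreover, for every $\varepsilon>0$ there is $h_0>0$ such that for all $j\in\mathbb{N}$ and all $h\in\mathbb{R}^3$ with $|h|<h_0$ both $$\int_\Omega dx\,\Big|\int_{\mathbb{S}^2}dn\int_0^Ddr\,[A_j(x,n,r)-A_j(x+h,n,r)]\Big|^2\le4\pi\int_\Omega dx\int_{\mathbb{S}^2}dn\,\Big|\int_0^Ddr\,[A_j(x,n,r)-A_j(x+h,n,r)]\Big|^2<\varepsilon$$ and $$\int_\Omega dx\,\Big|\int_{\mathbb{S}^2}dn\,f(n)[E_j(x,n,D)-E_j(x+h,n,D)]\Big|^2\le4\pi\|f\|_{L^\infty}\int_\Omega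 dx\int_{\mathbb{S}^2}dn\,f(n)\,\big|E_j(x,n,D)-E_j(x+h,n,D)\big|^2<\varepsilon .$$ -/

import Mathlib

open MeasureTheory Set Filter Topology
open scoped ENNReal RealInnerProductSpace

noncomputable section

/-- Euclidean three-space. -/
abbrev E3 : Type := EuclideanSpace ℝ (Fin 3)

/-- The unit sphere of directions in Euclidean three-space. -/
abbrev S2 : Type := Metric.sphere (0 : E3) 1

/-- The surface measure `dn` on the unit sphere (of total mass `4π`). -/
def sphereMeasure : Measure S2 := (volume : Measure E3).toSphere

/-- `ρ` is a `C¹` defining function of `Ω` in the open set `U`: it has no critical point in `U`,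
and inside `U` the set `Ω` is `{ρ < 0}`. -/
structure IsC1DefiningFunction (Ω U : Set E3) (ρ : E3 → ℝ) : Prop where
  isOpen : IsOpen U
  contDiffOn : ContDiffOn ℝ 1 ρ U
  gradient_ne_zero : ∀ x ∈ U, gradient ρ x ≠ 0
  inter_eq : Ω ∩ U = {x ∈ U | ρ x < 0}

/-- `Ω` has `C¹` boundary: near every boundary point it has a `C¹` defining function. -/
def HasC1Boundary (Ω : Set E3) : Prop :=
  ∀ p ∈ frontier Ω, ∃ (U : Set E3) (ρ : E3 → ℝ), p ∈ U ∧ IsC1DefiningFunction Ω U ρ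

/-- `ν` is the outward unit normal of `Ω` at `p`, given by the normalised gradient of a
defining function. -/
def IsOutwardUnitNormal (Ω : Set E3) (p ν : E3) : Prop :=
  ∃ (U : Set E3) (ρ : E3 → ℝ), p ∈ U ∧ IsC1DefiningFunction Ω U ρ ∧
    ν = ‖gradient ρ p‖⁻¹ • gradient ρ p

/-- The boundary of `Ω` is strictly positively curved: at each boundary point `p` the set `Ω`
lies, near `p`, below its tangent plane by at least a positive multiple of the squared distance
to `p`. When the boundary is `C²`, this says exactly that all principal curvatures, with respect
to the outward normal and with the sign that is positive for balls, are strictly positive; the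
condition makes sense when the boundary is only `C¹`. -/
def HasStrictlyPositiveCurvature (Ω : Set E3) : Prop :=
  ∀ p ∈ frontier Ω, ∀ ν : E3, IsOutwardUnitNormal Ω p ν →
    ∃ c : ℝ, 0 < c ∧ ∀ᶠ y in 𝓝[Ω] p, ⟪ν, y - p⟫ ≤ -c * ‖y - p‖ ^ 2

/-- The space `L^∞(Ω)`. -/
abbrev LInfty (Ω : Set E3) := Lp ℝ ∞ (volume.restrict Ω)

/-- The extension by zero to the whole space of an element of `L^∞(Ω)`. -/
def zeroExt {Ω : Set E3} (g : LInfty Ω) : E3 → ℝ := Ω.indicator g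

/-- The factor `exp (-∫₀^r ψ(x - λ n) dλ)`. -/
def attenuation (ψ : E3 → ℝ) (x : E3) (n : S2) (r : ℝ) : ℝ :=
  Real.exp (-∫ l in (0 : ℝ)..r, ψ (x - l • (n : E3)))

/-- The integrand `φ(x - r n) exp (-∫₀^r ψ(x - λ n) dλ)`. -/
def attenuatedSource (φ ψ : E3 → ℝ) (x : E3) (n : S2) (r : ℝ) : ℝ :=
  φ (x - r • (n : E3)) * attenuation ψ x n r

/-- `∫_{S²} dn ∫₀^D dr φ(x - r n) exp (-∫₀^r ψ(x - λ n) dλ)`. -/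
def interiorTerm (D : ℝ) (φ ψ : E3 → ℝ) (x : E3) : ℝ :=
  ∫ n, (∫ r in (0 : ℝ)..D, attenuatedSource φ ψ x n r) ∂sphereMeasure

/-- `∫_{S²} dn f(n) exp (-∫₀^D ψ(x - λ n) dλ)`. -/
def boundaryTerm (D : ℝ) (f : S2 → ℝ) (ψ : E3 → ℝ) (x : E3) : ℝ :=
  ∫ n, f n * attenuation ψ x n D ∂sphereMeasure

/-- A sequence of functions on `Ω` is compact in `L²(Ω)`: every member represents an element of
`L²(Ω)`, and the set of these elements is relatively compact. -/
def IsCompactSequenceInL2 (Ω : Set E3) (u : ℕ → E3 → ℝ) : Prop :=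
  ∃ U : ℕ → Lp ℝ 2 (volume.restrict Ω),
    (∀ j, U j =ᵐ[volume.restrict Ω] u j) ∧ IsCompact (closure (range U))

end

/-! The functions `φ` and `ψ` are only bounded, so their own translates need not be close uniformly
in `j`. Their segment integrals are better: averaging over directions smooths them, and by an amount
that depends only on the sup bound, the support and `D`.

Put `g = φ - φ(· + h)`. On each ray the square of a primitive is twice the integral of `g` times its
primitive. Integrating over `x` and `n` and shifting `x` along the ray gives `∫∫ |∫₀^r g(x - tn)
dt|² dn dx = 2 ∫ g(x) W(x) dx`, where `W` integrates `g(x + un)` over directions, over `0 < u < s`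
and over `0 < s < r` (`integral_sq_rayIntegral_eq`). For fixed `s`, polar coordinates turn the
integral over `n` and `u` into one of `g(x + y)` against the integrable kernel `|y|⁻²` cut off at
`|y| < s`. The difference in `g` can be moved onto this kernel, so `|W|` is at most `M` times an
`L¹` modulus of translation of fixed kernels, which tends to `0` with `h`
(`abs_integral_rayMeasure_translate_sub_le`, `tendsto_kernelModulus`). This yields
`exists_modulus_rayIntegral`.

The exponentials inherit the estimate because `exp` is Lipschitz on bounded intervals. For the
source term, an integration by parts along the ray replaces increments of `φ` by increments of its
segment integrals (`abs_integral_attenuatedSource_sub_le`). Cauchy–Schwarz on the sphere then gives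
both displayed inequalities, and compactness follows from a Kolmogorov–Riesz argument by averaging
over small balls (`isCompactSequenceInL2_of_equicontinuous`).

Elements of `L^∞` are first replaced by Borel functions bounded everywhere; by polar coordinates
this changes nothing on almost every ray through any given point. -/

/-! ### Calculus on the line: primitives of bounded measurable functions. -/

theorem Real.abs_exp_sub_exp_le {a b c : ℝ} (ha : a ≤ c) (hb : b ≤ c) :
    |Real.exp a - Real.exp b| ≤ Real.exp c * |a - b| := by
  wlog hab : b ≤ a generalizing a b
  · rw [abs_sub_comm, abs_sub_comm a]
    exact this hb ha (le_of_not_ge hab)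
  rw [abs_of_nonneg (sub_nonneg.2 (Real.exp_le_exp.2 hab)), abs_of_nonneg (sub_nonneg.2 hab)]
  have h1 : Real.exp b = Real.exp a * Real.exp (b - a) := by rw [← Real.exp_add]; ring_nf
  have h2 := Real.add_one_le_exp (b - a)
  have h3 := Real.exp_le_exp.2 ha
  have h4 := Real.exp_pos a
  calc Real.exp a - Real.exp b = Real.exp a * (1 - Real.exp (b - a)) := by rw [h1]; ring
    _ ≤ Real.exp a * (a - b) := mul_le_mul_of_nonneg_left (by linarith) h4.le
    _ ≤ _ := mul_le_mul_of_nonneg_right h3 (sub_nonneg.2 hab)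

theorem intervalIntegrable_of_abs_le {g : ℝ → ℝ} {M : ℝ} (hg : Measurable g)
    (hM : ∀ t, |g t| ≤ M) (a b : ℝ) : IntervalIntegrable g volume a b :=
  (intervalIntegrable_const (c := M)).mono_fun hg.aestronglyMeasurable
    (Eventually.of_forall fun t => by
      simpa using (hM t).trans (le_abs_self M))

theorem abs_intervalIntegral_le_of_abs_le {g : ℝ → ℝ} {M r : ℝ} (hr : 0 ≤ r)
    (hM : ∀ t, |g t| ≤ M) : |∫ t in (0 : ℝ)..r, g t| ≤ M * r := by
  have := intervalIntegral.norm_integral_le_of_norm_le_const (a := 0) (b := r) (f := g) (C := M)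
    fun t _ => hM t
  simpa [abs_of_nonneg hr] using this

theorem ae_hasDerivAt_primitive {g : ℝ → ℝ} {M : ℝ} (hg : Measurable g)
    (hM : ∀ t, |g t| ≤ M) :
    ∀ᵐ s, HasDerivAt (fun x => ∫ t in (0 : ℝ)..x, g t) (g s) s := by
  have : LocallyIntegrable g volume := by
    refine (locallyIntegrable_const M).mono hg.aestronglyMeasurable
      (Eventually.of_forall fun t => by simpa using (hM t).trans (le_abs_self M))
  filter_upwards [_root_.LocallyIntegrable.ae_hasDerivAt_integral this] with s hs using hs 0

theorem absolutelyContinuousOnInterval_primitive {g : ℝ → ℝ} {M : ℝ} (hg : Measurable g)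
    (hM : ∀ t, |g t| ≤ M) (r : ℝ) :
    AbsolutelyContinuousOnInterval (fun x => ∫ t in (0 : ℝ)..x, g t) 0 r :=
  (intervalIntegrable_of_abs_le hg hM 0 r).absolutelyContinuousOnInterval_intervalIntegral (by simp)

/-- The primitive `G` is absolutely continuous with `G' = g` almost everywhere, so the fundamental
theorem applies to `G²`, whose derivative is `2gG`. -/
theorem sq_intervalIntegral_eq {g : ℝ → ℝ} {M : ℝ} (hg : Measurable g)
    (hM : ∀ t, |g t| ≤ M) (r : ℝ) :
    (∫ t in (0 : ℝ)..r, g t) ^ 2 =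
      2 * ∫ s in (0 : ℝ)..r, g s * ∫ t in (0 : ℝ)..s, g t := by
  have hac := absolutelyContinuousOnInterval_primitive hg hM r
  have h := hac.integral_deriv_mul_eq_sub hac
  rw [← intervalIntegral.integral_const_mul]
  simp only [intervalIntegral.integral_same, mul_zero, sub_zero] at h
  rw [sq, ← h]
  apply intervalIntegral.integral_congr_ae
  filter_upwards [ae_hasDerivAt_primitive hg hM] with s hs _
  rw [hs.deriv]
  ring

theorem abs_primitive_sub_le {p : ℝ → ℝ} {M : ℝ} (hp : Measurable p) (hM : ∀ t, |p t| ≤ M)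
    (a b : ℝ) : |(∫ t in (0 : ℝ)..a, p t) - ∫ t in (0 : ℝ)..b, p t| ≤ M * |a - b| := by
  rw [intervalIntegral.integral_interval_sub_left (intervalIntegrable_of_abs_le hp hM _ _)
    (intervalIntegrable_of_abs_le hp hM _ _)]
  simpa using intervalIntegral.norm_integral_le_of_norm_le_const (f := p) (a := b) (b := a)
    fun t _ => hM t

theorem neg_primitive_le {p : ℝ → ℝ} {M D r : ℝ} (hM : ∀ t, |p t| ≤ M) (hr : r ∈ Icc 0 D) :
    -(∫ t in (0 : ℝ)..r, p t) ≤ M * D := by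
  have h0 : 0 ≤ M := (abs_nonneg _).trans (hM 0)
  calc -(∫ t in (0 : ℝ)..r, p t) ≤ |∫ t in (0 : ℝ)..r, p t| := neg_le_abs _
    _ ≤ M * r := abs_intervalIntegral_le_of_abs_le hr.1 hM
    _ ≤ M * D := by gcongr; exact hr.2

/-- Integrating by parts, an integral weighted by an exponential is controlled by the primitive. -/
theorem abs_integral_mul_exp_primitive_le {g p : ℝ → ℝ} {M K D : ℝ} (hD : 0 ≤ D)
    (hg : Measurable g) (hK : ∀ t, |g t| ≤ K) (hp : Measurable p) (hM : ∀ t, |p t| ≤ M) :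
    |∫ r in (0 : ℝ)..D, g r * Real.exp (-∫ t in (0 : ℝ)..r, p t)| ≤
      Real.exp (M * D) * (|∫ t in (0 : ℝ)..D, g t| +
        M * ∫ r in (0 : ℝ)..D, |∫ t in (0 : ℝ)..r, g t|) := by
  have h0 : 0 ≤ M := (abs_nonneg _).trans (hM 0)
  set E : ℝ → ℝ := fun r => Real.exp (-∫ t in (0 : ℝ)..r, p t) with hE
  set G : ℝ → ℝ := fun r => ∫ t in (0 : ℝ)..r, g t with hG
  have hG_ac : AbsolutelyContinuousOnInterval G 0 D :=
    absolutelyContinuousOnInterval_primitive hg hK D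
  have hE_le : ∀ r ∈ Icc 0 D, E r ≤ Real.exp (M * D) := fun r hr =>
    Real.exp_le_exp.2 (neg_primitive_le hM hr)
  have hE_lip : LipschitzOnWith (Real.toNNReal (Real.exp (M * D) * M)) E (uIcc 0 D) := by
    rw [uIcc_of_le hD]
    refine LipschitzOnWith.of_dist_le_mul fun a ha b hb => ?_
    rw [Real.dist_eq, Real.dist_eq, Real.coe_toNNReal _ (by positivity)]
    refine (Real.abs_exp_sub_exp_le (neg_primitive_le hM ha) (neg_primitive_le hM hb)).trans ?_
    rw [mul_assoc]
    gcongr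
    have := abs_primitive_sub_le hp hM a b
    rwa [← abs_neg, show -((-∫ t in (0 : ℝ)..a, p t) - -∫ t in (0 : ℝ)..b, p t) =
      (∫ t in (0 : ℝ)..a, p t) - ∫ t in (0 : ℝ)..b, p t by ring]
  have hE_ac := hE_lip.absolutelyContinuousOnInterval
  -- Both factors are absolutely continuous, so integration by parts is legitimate although `g` and
  -- `p` are merely bounded and measurable.
  have hparts := hE_ac.integral_mul_deriv_eq_deriv_mul hG_ac
  have hG0 : G 0 = 0 := by simp [hG]
  have h1 : ∫ r in (0 : ℝ)..D, g r * E r = ∫ r in (0 : ℝ)..D, E r * deriv G r := by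
    apply intervalIntegral.integral_congr_ae
    filter_upwards [ae_hasDerivAt_primitive hg hK] with s hs _
    rw [hs.deriv, mul_comm]
  have hGc : ContinuousOn G (uIcc 0 D) := hG_ac.continuousOn
  have h2 : |∫ r in (0 : ℝ)..D, deriv E r * G r| ≤
      ∫ r in (0 : ℝ)..D, Real.exp (M * D) * M * |G r| := by
    have hi : IntervalIntegrable (fun r => Real.exp (M * D) * M * |G r|) volume 0 D :=
      ContinuousOn.intervalIntegrable (continuousOn_const.mul hGc.abs)
    rw [← Real.norm_eq_abs]
    refine intervalIntegral.norm_integral_le_of_norm_le hD ?_ hi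
    filter_upwards [ae_hasDerivAt_primitive hp hM] with s hs hsD
    have hd : deriv E s = E s * -p s := (hs.neg.exp).deriv
    rw [hd, norm_mul, norm_mul, Real.norm_eq_abs, Real.norm_eq_abs, Real.norm_eq_abs, abs_neg]
    gcongr
    · rw [abs_of_pos (Real.exp_pos _)]
      exact hE_le s (Ioc_subset_Icc_self hsD)
    · exact hM s
  rw [h1, hparts, hG0, mul_zero, sub_zero]
  calc |E D * G D - ∫ r in (0 : ℝ)..D, deriv E r * G r|
      ≤ |E D * G D| + |∫ r in (0 : ℝ)..D, deriv E r * G r| := abs_sub _ _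
    _ ≤ Real.exp (M * D) * |G D| + ∫ r in (0 : ℝ)..D, Real.exp (M * D) * M * |G r| := by
        gcongr
        rw [abs_mul, abs_of_pos (Real.exp_pos _)]
        gcongr
        exact neg_primitive_le hM ⟨hD, le_rfl⟩
    _ = _ := by rw [intervalIntegral.integral_const_mul]; ring

/-! ### Polar coordinates and the kernel `|y|⁻²`. -/

theorem sphereMeasure_univ : sphereMeasure univ = ENNReal.ofReal (4 * Real.pi) := by
  rw [sphereMeasure, Measure.toSphere_apply_univ, EuclideanSpace.volume_ball_fin_three,
    finrank_euclideanSpace, Fintype.card_fin, ENNReal.ofReal_one, one_pow, one_mul,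
    ← ENNReal.ofReal_natCast, ← ENNReal.ofReal_mul (by positivity)]
  congr 1
  push_cast
  ring

instance : IsFiniteMeasure sphereMeasure :=
  ⟨by rw [sphereMeasure_univ]; exact ENNReal.ofReal_lt_top⟩

theorem sphereMeasure_real_univ : sphereMeasure.real univ = 4 * Real.pi := by
  rw [Measure.real, sphereMeasure_univ, ENNReal.toReal_ofReal (by positivity)]

/-- Integration in polar coordinates in Euclidean three-space. -/
theorem lintegral_eq_lintegral_sphere {F : E3 → ℝ≥0∞} (hF : Measurable F) :
    ∫⁻ y, F y = ∫⁻ n, (∫⁻ r in Ioi (0 : ℝ), ENNReal.ofReal (r ^ 2) * F (r • (n : E3)))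
      ∂sphereMeasure := by
  have hmp := (volume : Measure E3).measurePreserving_homeomorphUnitSphereProd
  have hmeas : Measurable fun p : S2 × Ioi (0 : ℝ) => F (p.2.1 • p.1.1) :=
    hF.comp (by fun_prop)
  have h1 := hmp.lintegral_comp_emb (Homeomorph.measurableEmbedding _)
    (fun p : S2 × Ioi (0 : ℝ) => F (p.2.1 • p.1.1))
  have h2 : ∀ a : ({0}ᶜ : Set E3), F ((homeomorphUnitSphereProd E3 a).2.1 •
      (homeomorphUnitSphereProd E3 a).1.1) = F a := by
    intro a
    rw [← homeomorphUnitSphereProd_symm_apply_coe, Homeomorph.symm_apply_apply]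
  simp only [h2] at h1
  rw [lintegral_subtype_comap (measurableSet_singleton _).compl F,
    restrict_compl_singleton, lintegral_prod _ hmeas.aemeasurable] at h1
  rw [h1, sphereMeasure]
  refine lintegral_congr fun n => ?_
  rw [Measure.volumeIoiPow, lintegral_withDensity_eq_lintegral_mul _ (by fun_prop)
    (g := fun r : Ioi (0 : ℝ) => F (r.1 • (n : E3))) (hF.comp (by fun_prop)), finrank_euclideanSpace,
    Fintype.card_fin]
  exact lintegral_subtype_comap measurableSet_Ioi
    (fun r : ℝ => ENNReal.ofReal (r ^ 2) * F (r • (n : E3)))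

/-- Almost every ray from a given point meets a null set in a set of length zero. -/
theorem ae_sphere_ae_ray {p : E3 → Prop} (hp : ∀ᵐ y, p y) (x : E3) :
    ∀ᵐ n : S2 ∂sphereMeasure, ∀ᵐ r : ℝ, 0 < r → p (x - r • (n : E3)) := by
  set N := toMeasurable volume {y | ¬ p y} with hN
  have hN0 : volume N = 0 := by rw [hN, measure_toMeasurable]; exact hp
  have hNm : MeasurableSet N := measurableSet_toMeasurable _ _
  have hNp : ∀ y, y ∉ N → p y := fun y hy => by
    by_contra h
    exact hy (subset_toMeasurable _ _ h)
  have hm : MeasurableSet ((fun y : E3 => x - y) ⁻¹' N) := hNm.preimage (by fun_prop)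
  have h0 : volume ((fun y : E3 => x - y) ⁻¹' N) = 0 := by
    rw [(Measure.measurePreserving_sub_left volume x).measure_preimage hNm.nullMeasurableSet, hN0]
  have h1 := lintegral_eq_lintegral_sphere (measurable_const.indicator hm :
    Measurable (((fun y : E3 => x - y) ⁻¹' N).indicator fun _ => (1 : ℝ≥0∞)))
  rw [lintegral_indicator_const hm, h0, mul_zero, eq_comm, lintegral_eq_zero_iff] at h1
  swap
  · apply Measurable.lintegral_prod_right' (f := fun q : S2 × ℝ => ENNReal.ofReal (q.2 ^ 2) *
      ((fun y : E3 => x - y) ⁻¹' N).indicator (fun _ => (1 : ℝ≥0∞)) (q.2 • (q.1 : E3)))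
    refine Measurable.mul (by fun_prop) ?_
    exact (measurable_const.indicator hm).comp (by fun_prop)
  filter_upwards [h1] with n hn
  rw [Pi.zero_apply, lintegral_eq_zero_iff] at hn
  swap
  · refine Measurable.mul (by fun_prop) ?_
    exact (measurable_const.indicator hm).comp (by fun_prop)
  rw [EventuallyEq, ae_restrict_iff' measurableSet_Ioi] at hn
  filter_upwards [hn] with r hr hr0
  refine hNp _ fun hmem => ?_
  -- On the bad set the polar integrand would equal the Jacobian `r²`, which is positive for `r >
  -- 0`.
  have h3 := hr hr0
  rw [indicator_of_mem (show r • (n : E3) ∈ (fun y : E3 => x - y) ⁻¹' N from hmem)] at h3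
  simp only [mul_one, Pi.zero_apply, ENNReal.ofReal_eq_zero] at h3
  exact absurd h3 (not_le.2 (pow_pos hr0 2))

/-- The kernel `|y|⁻²` truncated to the ball of radius `s`. -/
noncomputable def rayKernel (s : ℝ) (y : E3) : ℝ := if ‖y‖ < s then (‖y‖ ^ 2)⁻¹ else 0

theorem measurable_rayKernel_uncurry : Measurable fun q : ℝ × E3 => rayKernel q.1 q.2 :=
  Measurable.ite (measurableSet_lt (by fun_prop) (by fun_prop)) (by fun_prop) measurable_const

theorem measurable_rayKernel (s : ℝ) : Measurable (rayKernel s) :=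
  Measurable.ite (measurableSet_lt (by fun_prop) (by fun_prop)) (by fun_prop) measurable_const

theorem rayKernel_nonneg (s : ℝ) (y : E3) : 0 ≤ rayKernel s y := by
  unfold rayKernel; split_ifs <;> positivity

/-- The Jacobian `r²` cancels the singularity `|y|⁻²`, so in polar coordinates the kernel becomes
plain Lebesgue measure on a segment. -/
theorem sq_mul_rayKernel {s r : ℝ} (hr : 0 < r) (n : S2) :
    ENNReal.ofReal (r ^ 2) * ENNReal.ofReal (rayKernel s (r • (n : E3))) =
      (Iio s).indicator 1 r := by
  have hn : ‖r • (n : E3)‖ = r := by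
    rw [norm_smul, norm_eq_of_mem_sphere, mul_one, Real.norm_of_nonneg hr.le]
  rw [← ENNReal.ofReal_mul (by positivity), rayKernel, hn]
  by_cases h : r < s
  · rw [if_pos h, mul_inv_cancel₀ (by positivity), indicator_of_mem (show r ∈ Iio s from h)]
    simp
  · rw [if_neg h, indicator_of_notMem (show r ∉ Iio s from h)]
    simp

theorem lintegral_rayKernel_mul (s : ℝ) {F : E3 → ℝ≥0∞} (hF : Measurable F) :
    ∫⁻ y, ENNReal.ofReal (rayKernel s y) * F y =
      ∫⁻ n, (∫⁻ r in Ioc 0 s, F (r • (n : E3))) ∂sphereMeasure := by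
  rw [lintegral_eq_lintegral_sphere (F := fun y => ENNReal.ofReal (rayKernel s y) * F y)
    ((measurable_rayKernel s).ennreal_ofReal.mul hF)]
  refine lintegral_congr fun n => ?_
  have h1 : ∀ r ∈ Ioi (0 : ℝ), ENNReal.ofReal (r ^ 2) *
      (ENNReal.ofReal (rayKernel s (r • (n : E3))) * F (r • (n : E3))) =
      (Iio s).indicator (fun r => F (r • (n : E3))) r := by
    intro r hr
    rw [← mul_assoc, sq_mul_rayKernel hr]
    by_cases h : r ∈ Iio s <;> simp [h]
  rw [setLIntegral_congr_fun measurableSet_Ioi h1, lintegral_indicator measurableSet_Iio,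
    Measure.restrict_restrict measurableSet_Iio, inter_comm, Ioi_inter_Iio]
  exact setLIntegral_congr Ioo_ae_eq_Ioc

theorem lintegral_rayKernel {s : ℝ} (hs : 0 ≤ s) :
    ∫⁻ y, ENNReal.ofReal (rayKernel s y) = ENNReal.ofReal (4 * Real.pi * s) := by
  have := lintegral_rayKernel_mul s (F := fun _ => 1) measurable_const
  simp only [mul_one, lintegral_const, Measure.restrict_apply_univ, one_mul,
    sphereMeasure_univ, Real.volume_Ioc, sub_zero] at this
  rw [this, ← ENNReal.ofReal_mul hs, mul_comm]

theorem integrable_rayKernel (s : ℝ) : Integrable (rayKernel s) := by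
  refine ⟨(measurable_rayKernel s).aestronglyMeasurable, ?_⟩
  rw [hasFiniteIntegral_iff_ofReal (Eventually.of_forall (rayKernel_nonneg s))]
  rcases le_total 0 s with hs | hs
  · rw [lintegral_rayKernel hs]
    exact ENNReal.ofReal_lt_top
  · have : rayKernel s = 0 := by
      ext y
      rw [rayKernel, if_neg (not_lt.2 (hs.trans (norm_nonneg y)))]
      rfl
    simp [this]

/-- Translation is continuous in `L¹`. -/
theorem tendsto_integral_abs_sub_translate {k : E3 → ℝ} (hk : Integrable k) :
    Tendsto (fun h : E3 => ∫ y, |k y - k (y - h)|) (𝓝 0) (𝓝 0) := by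
  have : Fact ((1 : ℝ≥0∞) ≠ ∞) := ⟨ENNReal.one_ne_top⟩
  have hk1 : MemLp k 1 := memLp_one_iff_integrable.2 hk
  set F : Lp ℝ 1 (volume : Measure E3) := hk1.toLp k with hF
  have hcont : Continuous fun h : E3 => ‖F - (DomAddAct.mk (-h) +ᵥ F)‖ := by
    have h1 : Continuous fun h : E3 => DomAddAct.mk (-h) :=
      DomAddAct.continuous_mk.comp continuous_neg
    exact (continuous_const.sub (h1.vadd continuous_const)).norm
  have h0 := hcont.tendsto 0
  have hz : ‖F - (DomAddAct.mk (-(0 : E3)) +ᵥ F)‖ = 0 := by simp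
  rw [hz] at h0
  refine h0.congr fun h => ?_
  rw [hF, DomAddAct.mk_vadd_toLp, ← MemLp.toLp_sub, L1.norm_eq_integral_norm]
  have hsub : MemLp (k - fun x => k (-h +ᵥ x)) 1 volume :=
    hk1.sub (hk1.comp_measurePreserving (measurePreserving_vadd (-h) volume))
  refine integral_congr_ae ?_
  filter_upwards [MemLp.coeFn_toLp hsub] with y hy
  rw [hy]
  simp [sub_eq_neg_add]

/-- Recasts the polar identity as an equality of measures, which carries it over to integrands that
change sign. -/
theorem map_ray_eq_withDensity (s : ℝ) :
    (sphereMeasure.prod (volume.restrict (Ioc 0 s))).map (fun q : S2 × ℝ => q.2 • (q.1 : E3)) =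
      volume.withDensity fun y => ENNReal.ofReal (rayKernel s y) := by
  refine Measure.ext_of_lintegral _ fun F hF => ?_
  rw [lintegral_map hF (by fun_prop),
    lintegral_withDensity_eq_lintegral_mul _ (measurable_rayKernel s).ennreal_ofReal hF,
    lintegral_prod (fun q : S2 × ℝ => F (q.2 • (q.1 : E3))) (hF.comp (by fun_prop)).aemeasurable]
  exact (lintegral_rayKernel_mul s hF).symm

theorem integral_rayKernel_mul (s : ℝ) {F : E3 → ℝ} (hF : Measurable F) :
    ∫ y, rayKernel s y * F y =
      ∫ q : S2 × ℝ, F (q.2 • (q.1 : E3)) ∂(sphereMeasure.prod (volume.restrict (Ioc 0 s))) := by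
  rw [← integral_map (φ := fun q : S2 × ℝ => q.2 • (q.1 : E3)) (f := F)
    (by fun_prop) hF.aestronglyMeasurable, map_ray_eq_withDensity,
    integral_withDensity_eq_integral_toReal_smul (measurable_rayKernel s).ennreal_ofReal
      (Eventually.of_forall fun _ => ENNReal.ofReal_lt_top)]
  refine integral_congr_ae (Eventually.of_forall fun y => ?_)
  simp only [smul_eq_mul]
  rw [ENNReal.toReal_ofReal (rayKernel_nonneg s y)]

/-! ### Segment integrals and the energy identity. -/

/-- The integral of `g` along the segment of length `r` from `x` in direction `-n`. -/
noncomputable def rayIntegral (g : E3 → ℝ) (x : E3) (n : S2) (r : ℝ) : ℝ :=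
  ∫ t in (0 : ℝ)..r, g (x - t • (n : E3))

/-- Rescaling to a fixed interval makes joint measurability in `(x, n, r)` a statement about an
integral with parameters. -/
theorem rayIntegral_eq_mul (g : E3 → ℝ) (x : E3) (n : S2) (r : ℝ) :
    rayIntegral g x n r = r * ∫ t in Ioc (0 : ℝ) 1, g (x - (r * t) • (n : E3)) := by
  have h := intervalIntegral.smul_integral_comp_mul_left (a := 0) (b := 1)
    (fun t => g (x - t • (n : E3))) r
  rw [rayIntegral, ← intervalIntegral.integral_of_le zero_le_one]
  simpa using h.symm

theorem measurable_rayIntegral {α : Type*} [MeasurableSpace α] {g : E3 → ℝ} (hg : Measurable g)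
    {X : α → E3} {N : α → S2} {R : α → ℝ} (hX : Measurable X) (hN : Measurable N)
    (hR : Measurable R) : Measurable fun a => rayIntegral g (X a) (N a) (R a) := by
  simp_rw [rayIntegral_eq_mul]
  refine hR.mul ?_
  refine (StronglyMeasurable.integral_prod_right
    (f := fun a t => g (X a - (R a * t) • (N a : E3))) ?_).measurable
  exact (hg.comp (by fun_prop)).stronglyMeasurable

theorem abs_rayIntegral_le {g : E3 → ℝ} {K : ℝ} (hK : ∀ y, |g y| ≤ K) (x : E3) (n : S2) {r : ℝ}
    (hr : 0 ≤ r) : |rayIntegral g x n r| ≤ K * r :=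
  abs_intervalIntegral_le_of_abs_le hr fun _ => hK _

theorem rayIntegral_add_smul (g : E3 → ℝ) (x : E3) (n : S2) (s : ℝ) :
    rayIntegral g (x + s • (n : E3)) n s = ∫ u in (0 : ℝ)..s, g (x + u • (n : E3)) := by
  have h := intervalIntegral.integral_comp_sub_left (a := 0) (b := s)
    (fun u => g (x + u • (n : E3))) s
  rw [sub_self, sub_zero] at h
  rw [rayIntegral, ← h]
  refine intervalIntegral.integral_congr fun t _ => ?_
  simp only [sub_smul, add_sub_assoc]

/-- The measure `dn ds` on `S² × (0, r]`. -/
noncomputable def rayMeasure (r : ℝ) : Measure (S2 × ℝ) :=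
  sphereMeasure.prod (volume.restrict (Ioc 0 r))

instance (r : ℝ) : IsFiniteMeasure (rayMeasure r) := by unfold rayMeasure; infer_instance

theorem ae_rayMeasure_mem (r : ℝ) : ∀ᵐ q ∂rayMeasure r, q.2 ∈ Ioc 0 r :=
  Measure.quasiMeasurePreserving_snd.ae (ae_restrict_mem measurableSet_Ioc)

theorem integrable_prod_of_abs_le {α : Type*} [MeasurableSpace α] {ν : Measure α}
    [IsFiniteMeasure ν] {F : E3 × α → ℝ} (hF : Measurable F) {C R : ℝ}
    (hC : ∀ᵐ a ∂ν, ∀ x, |F (x, a)| ≤ C) (hR : ∀ᵐ a ∂ν, ∀ x, R < ‖x‖ → F (x, a) = 0) :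
    Integrable F (volume.prod ν) := by
  have hB : (volume.prod ν) (Metric.closedBall (0 : E3) R ×ˢ (univ : Set α)) ≠ ∞ := by
    rw [Measure.prod_prod]
    exact ENNReal.mul_ne_top measure_closedBall_lt_top.ne (measure_ne_top _ _)
  have hi : Integrable ((Metric.closedBall (0 : E3) R ×ˢ (univ : Set α)).indicator
      fun _ => C) (volume.prod ν) :=
    (integrable_indicator_iff (measurableSet_closedBall.prod MeasurableSet.univ)).2
      (integrableOn_const hB)
  refine hi.mono' hF.aestronglyMeasurable ?_
  filter_upwards [Measure.quasiMeasurePreserving_snd.ae hC,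
    Measure.quasiMeasurePreserving_snd.ae hR] with q h1 h2
  by_cases hq : ‖q.1‖ ≤ R
  · rw [indicator_of_mem (by simpa using hq)]
    exact h1 q.1
  · rw [indicator_of_notMem (by simpa using hq), h2 q.1 (not_le.1 hq)]
    simp

section Energy

variable {g : E3 → ℝ} {K R : ℝ}

/-- On each ray the square is twice the integral of `g(x - sn)` times the segment integral of length
`s`. Replacing `x` by `x + sn` frees the first factor of `s` and `n`, and reverses the segment in
the second. -/
theorem integral_sq_rayIntegral_eq (hg : Measurable g) (hK : ∀ y, |g y| ≤ K)
    (hR : ∀ y, R < ‖y‖ → g y = 0) {r : ℝ} (hr : 0 ≤ r) :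
    ∫ x, ∫ n, rayIntegral g x n r ^ 2 ∂sphereMeasure =
      2 * ∫ x, g x * ∫ q : S2 × ℝ, (∫ u in (0 : ℝ)..q.2, g (x + u • (q.1 : E3)))
        ∂rayMeasure r := by
  have hK0 : 0 ≤ K := (abs_nonneg _).trans (hK 0)
  set F : E3 × S2 × ℝ → ℝ := fun q =>
    g (q.1 - q.2.2 • (q.2.1 : E3)) * rayIntegral g q.1 q.2.1 q.2.2 with hFdef
  set W : E3 × S2 × ℝ → ℝ := fun q =>
    g q.1 * ∫ u in (0 : ℝ)..q.2.2, g (q.1 + u • (q.2.1 : E3)) with hWdef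
  have hFm : Measurable F := (hg.comp (by fun_prop)).mul
    (measurable_rayIntegral hg (by fun_prop) (by fun_prop) (by fun_prop))
  have hWm : Measurable W := by
    simp only [hWdef, ← rayIntegral_add_smul]
    exact (hg.comp (by fun_prop)).mul
      (measurable_rayIntegral hg (by fun_prop) (by fun_prop) (by fun_prop))
  have hbound : ∀ q ∈ {q : S2 × ℝ | q.2 ∈ Ioc 0 r}, ∀ x y, |g y * rayIntegral g x q.1 q.2| ≤
      K * (K * r) := fun q hq x y => by
    rw [abs_mul]
    refine mul_le_mul (hK y) ((abs_rayIntegral_le hK x q.1 hq.1.le).trans ?_) (abs_nonneg _) hK0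
    gcongr
    exact hq.2
  have hFi : Integrable F (volume.prod (rayMeasure r)) := by
    refine integrable_prod_of_abs_le hFm (C := K * (K * r)) (R := R + r) ?_ ?_
    · filter_upwards [ae_rayMeasure_mem r] with q hq x using hbound q hq x _
    · filter_upwards [ae_rayMeasure_mem r] with q hq x hx
      have h1 : g (x - q.2 • (q.1 : E3)) = 0 := by
        refine hR _ ?_
        have h2 := norm_sub_norm_le x (q.2 • (q.1 : E3))
        rw [norm_smul, norm_eq_of_mem_sphere, mul_one, Real.norm_of_nonneg hq.1.le] at h2
        linarith [hq.2]
      simp only [hFdef, h1, zero_mul]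
  have hWi : Integrable W (volume.prod (rayMeasure r)) := by
    refine integrable_prod_of_abs_le hWm (C := K * (K * r)) (R := R) ?_ ?_
    · filter_upwards [ae_rayMeasure_mem r] with q hq x
      simp only [hWdef, ← rayIntegral_add_smul]
      exact hbound q hq _ _
    · filter_upwards with q x hx
      simp only [hWdef, hR x hx, zero_mul]
  have hFx : ∀ x, ∫ n, rayIntegral g x n r ^ 2 ∂sphereMeasure =
      2 * ∫ q, F (x, q) ∂rayMeasure r := by
    intro x
    have hi : Integrable (fun q => F (x, q)) (rayMeasure r) := by
      refine (integrable_const (K * (K * r))).mono'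
        (hFm.comp (by fun_prop)).aestronglyMeasurable ?_
      filter_upwards [ae_rayMeasure_mem r] with q hq using hbound q hq x _
    rw [rayMeasure, integral_prod _ hi, ← integral_const_mul]
    refine integral_congr_ae (Eventually.of_forall fun n => ?_)
    simp only
    rw [← intervalIntegral.integral_of_le hr]
    exact sq_intervalIntegral_eq (hg.comp (by fun_prop)) (fun t => hK _) r
  simp_rw [hFx]
  rw [integral_const_mul, integral_integral_swap hFi]
  -- With `q` outermost the shift is by a constant vector, so translation invariance applies; Fubini
  -- before and after is justified by `hFi` and `hWi`.
  have hshift : ∀ q : S2 × ℝ, ∫ x, F (x, q) = ∫ x, W (x, q) := by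
    intro q
    rw [← integral_add_right_eq_self _ (q.2 • (q.1 : E3))]
    refine integral_congr_ae (Eventually.of_forall fun x => ?_)
    simp only [hFdef, hWdef, add_sub_cancel_right, rayIntegral_add_smul]
  simp_rw [hshift]
  rw [← integral_integral_swap hWi]
  simp only [hWdef, integral_const_mul]

/-- By the energy identity the left side pairs `g` with its direction average; the pairing is at
most the sup of the average times the `L¹` norm of `g`. Smallness is thus needed only of the
average. -/
theorem lintegral_sq_rayIntegral_le (hg : Measurable g) (hK : ∀ y, |g y| ≤ K)
    (hR : ∀ y, R < ‖y‖ → g y = 0) {r : ℝ} (hr : 0 ≤ r) {C : ℝ}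
    (hC : ∀ x, |∫ q : S2 × ℝ, (∫ u in (0 : ℝ)..q.2, g (x + u • (q.1 : E3))) ∂rayMeasure r| ≤ C) :
    ∫⁻ x, ∫⁻ n, ‖rayIntegral g x n r‖ₑ ^ 2 ∂sphereMeasure ≤
      ENNReal.ofReal (2 * (C * ∫ x, |g x|)) := by
  have hK0 : 0 ≤ K := (abs_nonneg _).trans (hK 0)
  have hm : Measurable fun q : E3 × S2 => rayIntegral g q.1 q.2 r ^ 2 :=
    (measurable_rayIntegral hg (by fun_prop) (by fun_prop) (by fun_prop)).pow_const 2
  have hi : Integrable (fun q : E3 × S2 => rayIntegral g q.1 q.2 r ^ 2)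
      (volume.prod sphereMeasure) := by
    refine integrable_prod_of_abs_le hm (C := (K * r) ^ 2) (R := R + r) ?_ ?_
    · filter_upwards with n x
      rw [abs_pow]
      exact pow_le_pow_left₀ (abs_nonneg _) (abs_rayIntegral_le hK x n hr) 2
    · filter_upwards with n x hx
      have h1 : rayIntegral g x n r = 0 := by
        rw [rayIntegral, intervalIntegral.integral_congr (g := fun _ => 0)]
        · simp
        · intro t ht
          rw [uIcc_of_le hr] at ht
          refine hR _ ?_
          have h2 := norm_sub_norm_le x (t • (n : E3))
          rw [norm_smul, norm_eq_of_mem_sphere, mul_one, Real.norm_of_nonneg ht.1] at h2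
          linarith [ht.2]
      simp [h1]
  have hgi : Integrable g := by
    have hb : Integrable ((Metric.closedBall (0 : E3) R).indicator fun _ => K) :=
      (integrable_indicator_iff measurableSet_closedBall).2
        (integrableOn_const measure_closedBall_lt_top.ne)
    refine hb.mono' hg.aestronglyMeasurable (Eventually.of_forall fun x => ?_)
    by_cases hx : ‖x‖ ≤ R
    · rw [indicator_of_mem (by simpa using hx)]
      exact hK x
    · rw [indicator_of_notMem (by simpa using hx), hR x (not_le.1 hx)]
      simp
  have h1 : ∫⁻ x, ∫⁻ n, ‖rayIntegral g x n r‖ₑ ^ 2 ∂sphereMeasure =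
      ENNReal.ofReal (∫ x, ∫ n, rayIntegral g x n r ^ 2 ∂sphereMeasure) := by
    rw [← integral_prod _ hi, ofReal_integral_eq_lintegral_ofReal hi
      (Eventually.of_forall fun q => sq_nonneg _),
      lintegral_prod _ hm.ennreal_ofReal.aemeasurable]
    refine lintegral_congr fun x => lintegral_congr fun n => ?_
    rw [← enorm_pow, Real.enorm_of_nonneg (sq_nonneg _)]
  rw [h1, integral_sq_rayIntegral_eq hg hK hR hr]
  refine ENNReal.ofReal_le_ofReal ?_
  gcongr
  rw [← integral_const_mul]
  refine (le_abs_self _).trans ?_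
  rw [← Real.norm_eq_abs]
  refine norm_integral_le_of_norm_le (hgi.abs.const_mul C) (Eventually.of_forall fun x => ?_)
  rw [norm_mul, mul_comm]
  exact mul_le_mul_of_nonneg_right (hC x) (abs_nonneg _)

end Energy

/-! ### Translation modulus of the kernel and of segment integrals. -/

theorem integral_rayKernel {s : ℝ} (hs : 0 ≤ s) : ∫ y, rayKernel s y = 4 * Real.pi * s := by
  rw [integral_eq_lintegral_of_nonneg_ae (Eventually.of_forall (rayKernel_nonneg s))
    (measurable_rayKernel s).aestronglyMeasurable, lintegral_rayKernel hs,
    ENNReal.toReal_ofReal (by positivity)]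

theorem integrable_rayKernel_sub (s : ℝ) (h : E3) :
    Integrable fun y => rayKernel s y - rayKernel s (y - h) :=
  (integrable_rayKernel s).sub ((integrable_rayKernel s).comp_sub_right h)

theorem integral_abs_rayKernel_sub_le {s : ℝ} (hs : 0 ≤ s) (h : E3) :
    ∫ y, |rayKernel s y - rayKernel s (y - h)| ≤ 8 * Real.pi * s := by
  have h1 := integrable_rayKernel s
  have h2 := h1.comp_sub_right h
  calc ∫ y, |rayKernel s y - rayKernel s (y - h)|
      ≤ ∫ y, (rayKernel s y + rayKernel s (y - h)) := by
        refine integral_mono (integrable_rayKernel_sub s h).abs (h1.add h2) fun y => ?_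
        refine (abs_sub _ _).trans_eq ?_
        rw [abs_of_nonneg (rayKernel_nonneg _ _), abs_of_nonneg (rayKernel_nonneg _ _)]
    _ = 8 * Real.pi * s := by
        rw [integral_add h1 h2, integral_sub_right_eq_self, integral_rayKernel hs]
        ring

/-- The mean over `s ∈ (0, D]` of the `L¹` distance of `rayKernel s` to its translate by `h`. -/
noncomputable def kernelModulus (D : ℝ) (h : E3) : ℝ :=
  ∫ s in Ioc 0 D, ∫ y, |rayKernel s y - rayKernel s (y - h)|

theorem stronglyMeasurable_integral_abs_rayKernel_sub (h : E3) :
    StronglyMeasurable fun s => ∫ y, |rayKernel s y - rayKernel s (y - h)| := by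
  refine StronglyMeasurable.integral_prod_right
    (f := fun (s : ℝ) (y : E3) => |rayKernel s y - rayKernel s (y - h)|) ?_
  have h1 : Measurable fun q : ℝ × E3 => rayKernel q.1 (q.2 - h) :=
    Measurable.ite (measurableSet_lt (by fun_prop) (by fun_prop)) (by fun_prop) measurable_const
  exact (measurable_rayKernel_uncurry.sub h1).abs.stronglyMeasurable

theorem abs_integral_abs_rayKernel_sub_le {s D : ℝ} (hs : s ∈ Ioc 0 D) (h : E3) :
    ‖∫ y, |rayKernel s y - rayKernel s (y - h)|‖ ≤ 8 * Real.pi * D := by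
  rw [Real.norm_of_nonneg (integral_nonneg fun _ => abs_nonneg _)]
  refine (integral_abs_rayKernel_sub_le hs.1.le h).trans ?_
  gcongr
  exact hs.2

theorem integrableOn_integral_abs_rayKernel_sub (D : ℝ) (h : E3) :
    IntegrableOn (fun s => ∫ y, |rayKernel s y - rayKernel s (y - h)|) (Ioc 0 D) :=
  (integrable_const (8 * Real.pi * D)).mono'
    (stronglyMeasurable_integral_abs_rayKernel_sub h).aestronglyMeasurable
    ((ae_restrict_mem measurableSet_Ioc).mono fun _ hs => abs_integral_abs_rayKernel_sub_le hs h)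

/-- For each `s` translation is continuous in `L¹`; dominated convergence in `s` applies because the
inner integrals never exceed `8πD`. -/
theorem tendsto_kernelModulus (D : ℝ) : Tendsto (kernelModulus D) (𝓝 0) (𝓝 0) := by
  have h := tendsto_integral_filter_of_dominated_convergence (μ := volume.restrict (Ioc 0 D))
    (l := 𝓝 (0 : E3)) (F := fun h s => ∫ y, |rayKernel s y - rayKernel s (y - h)|)
    (f := fun _ => (0 : ℝ)) (fun _ => 8 * Real.pi * D)
    (Eventually.of_forall fun h =>
      (stronglyMeasurable_integral_abs_rayKernel_sub h).aestronglyMeasurable)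
    (Eventually.of_forall fun h => (ae_restrict_mem measurableSet_Ioc).mono fun _ hs =>
      abs_integral_abs_rayKernel_sub_le hs h)
    (integrable_const _)
    (Eventually.of_forall fun s => tendsto_integral_abs_sub_translate (integrable_rayKernel s))
  rw [integral_zero] at h
  exact h

/-- A change of variables moves the translation from `φ`, which has no regularity, onto the kernel,
which does not depend on `φ`. This is the source of uniformity in `j`. -/
theorem integral_rayKernel_mul_translate_sub {φ : E3 → ℝ} {M : ℝ} (hφ : Measurable φ)
    (hM : ∀ y, |φ y| ≤ M) (s : ℝ) (x h : E3) :
    |∫ y, rayKernel s y * (φ (x + y) - φ (x + y + h))| ≤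
      M * ∫ y, |rayKernel s y - rayKernel s (y - h)| := by
  have hk := integrable_rayKernel s
  have h1 : Integrable fun y => rayKernel s y * φ (x + y) :=
    hk.mul_bdd (c := M) (hφ.comp (by fun_prop)).aestronglyMeasurable (Eventually.of_forall fun y => hM _)
  have h2 : Integrable fun y => rayKernel s y * φ (x + y + h) :=
    hk.mul_bdd (c := M) (hφ.comp (by fun_prop)).aestronglyMeasurable (Eventually.of_forall fun y => hM _)
  have h3 : Integrable fun y => rayKernel s (y - h) * φ (x + y) :=
    (hk.comp_sub_right h).mul_bdd (c := M) (hφ.comp (by fun_prop)).aestronglyMeasurable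
      (Eventually.of_forall fun y => hM _)
  have h4 : ∫ y, rayKernel s y * φ (x + y + h) = ∫ y, rayKernel s (y - h) * φ (x + y) := by
    rw [← integral_add_right_eq_self (fun y => rayKernel s (y - h) * φ (x + y)) h]
    simp only [add_sub_cancel_right, add_assoc]
  simp_rw [mul_sub]
  rw [integral_sub h1 h2, h4, ← integral_sub h1 h3, ← integral_const_mul, ← Real.norm_eq_abs]
  refine norm_integral_le_of_norm_le ((integrable_rayKernel_sub s h).abs.const_mul M)
    (Eventually.of_forall fun y => ?_)
  rw [← sub_mul, norm_mul, mul_comm]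
  exact mul_le_mul_of_nonneg_right (hM _) (abs_nonneg _)

theorem abs_integral_rayMeasure_translate_sub_le {φ : E3 → ℝ} {M r D : ℝ} (hφ : Measurable φ)
    (hM : ∀ y, |φ y| ≤ M) (hrD : r ≤ D) (x h : E3) :
    |∫ q : S2 × ℝ, (∫ u in (0 : ℝ)..q.2, (φ (x + u • (q.1 : E3)) - φ (x + u • (q.1 : E3) + h)))
      ∂rayMeasure r| ≤ M * kernelModulus D h := by
  have hM0 : 0 ≤ M := (abs_nonneg _).trans (hM 0)
  set g : E3 → ℝ := fun y => φ y - φ (y + h) with hg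
  have hgm : Measurable g := hφ.sub (hφ.comp (by fun_prop))
  have hgM : ∀ y, |g y| ≤ 2 * M := fun y =>
    (abs_sub _ _).trans (by linarith [hM y, hM (y + h)])
  have hi : Integrable (fun q : S2 × ℝ => ∫ u in (0 : ℝ)..q.2, g (x + u • (q.1 : E3)))
      (rayMeasure r) := by
    simp only [← rayIntegral_add_smul]
    refine (integrable_const (2 * M * r)).mono'
      (measurable_rayIntegral hgm (by fun_prop) (by fun_prop) (by fun_prop)).aestronglyMeasurable ?_
    filter_upwards [ae_rayMeasure_mem r] with q hq
    refine (abs_rayIntegral_le hgM _ q.1 hq.1.le).trans ?_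
    gcongr
    exact hq.2
  have hinner : ∀ s ∈ Ioc 0 r, ∫ n : S2, (∫ u in (0 : ℝ)..s, g (x + u • (n : E3))) ∂sphereMeasure =
      ∫ y, rayKernel s y * g (x + y) := by
    intro s hs
    rw [integral_rayKernel_mul s (F := fun y => g (x + y)) (hgm.comp (by fun_prop)),
      integral_prod]
    · refine integral_congr_ae (Eventually.of_forall fun n => ?_)
      simp only
      rw [intervalIntegral.integral_of_le hs.1.le]
    · exact (integrable_const (2 * M)).mono' (hgm.comp (by fun_prop)).aestronglyMeasurable
        (Eventually.of_forall fun _ => hgM _)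
  rw [rayMeasure] at hi ⊢
  rw [integral_prod_symm _ hi, setIntegral_congr_fun measurableSet_Ioc hinner, ← Real.norm_eq_abs]
  refine (norm_integral_le_of_norm_le
    ((integrableOn_integral_abs_rayKernel_sub r h).const_mul M)
    (Eventually.of_forall fun s => integral_rayKernel_mul_translate_sub hφ hM s x h)).trans ?_
  rw [integral_const_mul]
  refine mul_le_mul_of_nonneg_left ?_ hM0
  -- Enlarging the range of `s` from `(0, r]` to `(0, D]` makes the bound independent of `r`.
  exact setIntegral_mono_set (integrableOn_integral_abs_rayKernel_sub D h)
    (Eventually.of_forall fun s => integral_nonneg fun _ => abs_nonneg _)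
    (Ioc_subset_Ioc_right hrD).eventuallyLE

/-- A measurable function bounded by `M` that vanishes outside the ball of radius `R`. -/
structure IsBoundedWithin (M R : ℝ) (φ : E3 → ℝ) : Prop where
  measurable : Measurable φ
  abs_le : ∀ y, |φ y| ≤ M
  eq_zero : ∀ y, R < ‖y‖ → φ y = 0

theorem IsBoundedWithin.nonneg {M R : ℝ} {φ : E3 → ℝ} (hφ : IsBoundedWithin M R φ) : 0 ≤ M :=
  (abs_nonneg _).trans (hφ.abs_le 0)

theorem IsBoundedWithin.intervalIntegrable_ray {M R : ℝ} {φ : E3 → ℝ} (hφ : IsBoundedWithin M R φ)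
    (x : E3) (n : S2) (a b : ℝ) :
    IntervalIntegrable (fun t : ℝ => φ (x - t • (n : E3))) volume a b :=
  intervalIntegrable_of_abs_le (hφ.measurable.comp (by fun_prop)) (fun _ => hφ.abs_le _) a b

/-- Increments of segment integrals of uniformly bounded functions are uniformly small in `L²`. -/
theorem exists_modulus_rayIntegral (M R D : ℝ) :
    ∃ ω : E3 → ℝ≥0∞, Tendsto ω (𝓝 0) (𝓝 0) ∧ ∀ φ, IsBoundedWithin M R φ → ∀ r ∈ Icc 0 D,
      ∀ h : E3, ‖h‖ ≤ 1 → ∫⁻ x, ∫⁻ n, ‖rayIntegral φ x n r - rayIntegral φ (x + h) n r‖ₑ ^ 2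
        ∂sphereMeasure ≤ ω h := by
  -- For `‖h‖ ≤ 1` the increment `φ - φ(· + h)` lives in the ball of radius `R + 1` and is bounded
  -- by `2M`, so `2MV` bounds its `L¹` norm.
  set V : ℝ := (volume : Measure E3).real (Metric.closedBall 0 (R + 1)) with hV
  refine ⟨fun h => ENNReal.ofReal (2 * (M * kernelModulus D h * (2 * M * V))), ?_, ?_⟩
  · have h1 := ENNReal.tendsto_ofReal
      ((((tendsto_kernelModulus D).const_mul M).mul_const (2 * M * V)).const_mul 2)
    simpa using h1
  · intro φ hφ r hr h hh
    have hM0 := hφ.nonneg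
    set g : E3 → ℝ := fun y => φ y - φ (y + h) with hg
    have hgm : Measurable g := hφ.measurable.sub (hφ.measurable.comp (by fun_prop))
    have hgM : ∀ y, |g y| ≤ 2 * M := fun y =>
      (abs_sub _ _).trans (by linarith [hφ.abs_le y, hφ.abs_le (y + h)])
    have hgR : ∀ y, R + 1 < ‖y‖ → g y = 0 := fun y hy => by
      have h1 : ‖y‖ ≤ ‖y + h‖ + ‖h‖ := by simpa using norm_sub_le (y + h) h
      simp only [hg]
      rw [hφ.eq_zero y (by linarith), hφ.eq_zero (y + h) (by linarith), sub_zero]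
    have hsub : ∀ x n, rayIntegral φ x n r - rayIntegral φ (x + h) n r = rayIntegral g x n r := by
      intro x n
      rw [rayIntegral, rayIntegral, rayIntegral, ← intervalIntegral.integral_sub
        (hφ.intervalIntegrable_ray x n 0 r) (hφ.intervalIntegrable_ray (x + h) n 0 r)]
      simp only [hg, sub_add_eq_add_sub]
    simp_rw [hsub]
    refine (lintegral_sq_rayIntegral_le hgm hgM hgR hr.1
      (abs_integral_rayMeasure_translate_sub_le hφ.measurable hφ.abs_le hr.2 · h)).trans ?_
    refine ENNReal.ofReal_le_ofReal ?_
    have hint : ∫ x, |g x| ≤ 2 * M * V := by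
      calc ∫ x, |g x| ≤ ∫ x, (Metric.closedBall (0 : E3) (R + 1)).indicator (fun _ => 2 * M) x := by
            refine integral_mono_of_nonneg (Eventually.of_forall fun _ => abs_nonneg _)
              ((integrable_indicator_iff measurableSet_closedBall).2
                (integrableOn_const measure_closedBall_lt_top.ne))
              (Eventually.of_forall fun x => ?_)
            by_cases hx : ‖x‖ ≤ R + 1
            · simp only [indicator_of_mem (show x ∈ Metric.closedBall (0 : E3) (R + 1) by simpa)]
              exact hgM x
            · simp only [hgR x (not_le.1 hx), abs_zero]
              exact indicator_nonneg (fun _ _ => by positivity) x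
        _ = 2 * M * V := by
            rw [integral_indicator measurableSet_closedBall, setIntegral_const, smul_eq_mul,
              mul_comm]
    have hk0 : 0 ≤ kernelModulus D h :=
      integral_nonneg fun s => integral_nonneg fun _ => abs_nonneg _
    gcongr

/-! ### Weighted Cauchy–Schwarz and squares of sums. -/

/-- Hölder with exponents `2, 2` after splitting `wF = w^(1/2) · w^(1/2)F`. -/
theorem ENNReal.sq_lintegral_mul_le {α : Type*} [MeasurableSpace α] {μ : Measure α}
    {w F : α → ℝ≥0∞} (hw : AEMeasurable w μ) (hF : AEMeasurable F μ) :
    (∫⁻ a, w a * F a ∂μ) ^ 2 ≤ (∫⁻ a, w a ∂μ) * ∫⁻ a, w a * F a ^ 2 ∂μ := by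
  have h := ENNReal.lintegral_mul_le_Lp_mul_Lq μ Real.HolderConjugate.two_two
    (f := fun a => w a ^ (1 / 2 : ℝ)) (g := fun a => w a ^ (1 / 2 : ℝ) * F a)
    (hw.pow_const _) ((hw.pow_const _).mul hF)
  have h1 : ∀ a, w a ^ (1 / 2 : ℝ) * w a ^ (1 / 2 : ℝ) = w a := fun a => by
    rw [← ENNReal.rpow_add_of_nonneg _ _ (by norm_num) (by norm_num)]; norm_num
  have h2 : ∀ b : ℝ≥0∞, (b ^ (1 / 2 : ℝ)) ^ (2 : ℝ) = b := fun b => by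
    rw [← ENNReal.rpow_mul]; norm_num
  simp only [Pi.mul_apply, ← mul_assoc, h1, ENNReal.mul_rpow_of_nonneg _ _ zero_le_two, h2] at h
  calc (∫⁻ a, w a * F a ∂μ) ^ 2
      ≤ ((∫⁻ a, w a ∂μ) ^ (1 / 2 : ℝ) * (∫⁻ a, w a * F a ^ (2 : ℝ) ∂μ) ^ (1 / 2 : ℝ)) ^ 2 := by
        gcongr
    _ = _ := by
        rw [← ENNReal.rpow_two, ENNReal.mul_rpow_of_nonneg _ _ zero_le_two, h2, h2]
        simp only [ENNReal.rpow_two]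

theorem ENNReal.sq_lintegral_le {α : Type*} [MeasurableSpace α] {μ : Measure α}
    {F : α → ℝ≥0∞} (hF : AEMeasurable F μ) :
    (∫⁻ a, F a ∂μ) ^ 2 ≤ μ univ * ∫⁻ a, F a ^ 2 ∂μ := by
  simpa using ENNReal.sq_lintegral_mul_le (w := fun _ => 1) aemeasurable_const hF

theorem ENNReal.add_add_sq_le (a b c : ℝ≥0∞) :
    (a + b + c) ^ 2 ≤ 9 * (a ^ 2 + b ^ 2 + c ^ 2) := by
  set m := max a (max b c) with hm
  have ha : a ≤ m := le_max_left _ _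
  have hb : b ≤ m := (le_max_left _ _).trans (le_max_right _ _)
  have hc : c ≤ m := (le_max_right _ _).trans (le_max_right _ _)
  have h1 : (a + b + c) ^ 2 ≤ 9 * m ^ 2 := by
    calc (a + b + c) ^ 2 ≤ (m + m + m) ^ 2 := by gcongr
      _ = 9 * m ^ 2 := by ring
  refine h1.trans ?_
  gcongr
  rcases max_choice a (max b c) with h | h
  · rw [hm, h, add_assoc]
    exact le_self_add
  · rw [hm, h]
    rcases max_choice b c with h' | h'
    · rw [h', add_right_comm]
      exact le_add_self
    · rw [h']
      exact le_add_self

/-! ### Pointwise estimates for the attenuation and the attenuated source. -/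

section Attenuation

variable {M R : ℝ} {φ ψ : E3 → ℝ}

theorem attenuation_eq (ψ : E3 → ℝ) (x : E3) (n : S2) (r : ℝ) :
    attenuation ψ x n r = Real.exp (-rayIntegral ψ x n r) := rfl

theorem IsBoundedWithin.neg_rayIntegral_le (hψ : IsBoundedWithin M R ψ) (x : E3) (n : S2)
    {r D : ℝ} (hr : r ∈ Icc 0 D) : -rayIntegral ψ x n r ≤ M * D :=
  neg_primitive_le (fun _ => hψ.abs_le _) hr

theorem IsBoundedWithin.abs_attenuation_le (hψ : IsBoundedWithin M R ψ) (x : E3) (n : S2)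
    {r D : ℝ} (hr : r ∈ Icc 0 D) : |attenuation ψ x n r| ≤ Real.exp (M * D) := by
  rw [attenuation_eq, abs_of_pos (Real.exp_pos _)]
  exact Real.exp_le_exp.2 (hψ.neg_rayIntegral_le x n hr)

theorem IsBoundedWithin.abs_attenuation_sub_le (hψ : IsBoundedWithin M R ψ) (x y : E3) (n : S2)
    {r D : ℝ} (hr : r ∈ Icc 0 D) : |attenuation ψ x n r - attenuation ψ y n r| ≤
      Real.exp (M * D) * |rayIntegral ψ x n r - rayIntegral ψ y n r| := by
  have h := Real.abs_exp_sub_exp_le (hψ.neg_rayIntegral_le x n hr) (hψ.neg_rayIntegral_le y n hr)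
  rwa [neg_sub_neg, abs_sub_comm (rayIntegral ψ y n r)] at h

theorem IsBoundedWithin.measurable_attenuation (hψ : IsBoundedWithin M R ψ) {α : Type*}
    [MeasurableSpace α] {X : α → E3} {N : α → S2} {r : α → ℝ} (hX : Measurable X)
    (hN : Measurable N) (hr : Measurable r) :
    Measurable fun a => attenuation ψ (X a) (N a) (r a) := by
  simp only [attenuation_eq]
  exact (measurable_rayIntegral hψ.measurable hX hN hr).neg.exp

theorem measurable_attenuatedSource (hφ : IsBoundedWithin M R φ) (hψ : IsBoundedWithin M R ψ)
    {α : Type*} [MeasurableSpace α] {X : α → E3} {N : α → S2} {r : α → ℝ} (hX : Measurable X)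
    (hN : Measurable N) (hr : Measurable r) :
    Measurable fun a => attenuatedSource φ ψ (X a) (N a) (r a) :=
  (hφ.measurable.comp (by fun_prop)).mul (hψ.measurable_attenuation hX hN hr)

theorem abs_attenuatedSource_le (hφ : IsBoundedWithin M R φ) (hψ : IsBoundedWithin M R ψ)
    (x : E3) (n : S2) {r D : ℝ} (hr : r ∈ Icc 0 D) :
    |attenuatedSource φ ψ x n r| ≤ M * Real.exp (M * D) := by
  rw [attenuatedSource, abs_mul]
  exact mul_le_mul (hφ.abs_le _) (hψ.abs_attenuation_le x n hr) (abs_nonneg _) hφ.nonneg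

theorem intervalIntegrable_attenuatedSource (hφ : IsBoundedWithin M R φ)
    (hψ : IsBoundedWithin M R ψ) (x : E3) (n : S2) {D : ℝ} (hD : 0 ≤ D) :
    IntervalIntegrable (attenuatedSource φ ψ x n) volume 0 D := by
  rw [intervalIntegrable_iff_integrableOn_Ioc_of_le hD]
  refine (integrable_const (M * Real.exp (M * D))).mono'
    (measurable_attenuatedSource hφ hψ measurable_const measurable_const
      measurable_id).aestronglyMeasurable ?_
  filter_upwards [ae_restrict_mem measurableSet_Ioc] with r hr
  exact abs_attenuatedSource_le hφ hψ x n (Ioc_subset_Icc_self hr)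

theorem abs_integral_attenuatedSource_le (hφ : IsBoundedWithin M R φ)
    (hψ : IsBoundedWithin M R ψ) (x : E3) (n : S2) {D : ℝ} (hD : 0 ≤ D) :
    |∫ r in (0 : ℝ)..D, attenuatedSource φ ψ x n r| ≤ M * Real.exp (M * D) * D := by
  have := intervalIntegral.norm_integral_le_of_norm_le_const (a := 0) (b := D)
    (f := attenuatedSource φ ψ x n) (C := M * Real.exp (M * D)) fun r hr => by
      rw [uIoc_of_le hD] at hr
      exact abs_attenuatedSource_le hφ hψ x n (Ioc_subset_Icc_self hr)
  rwa [sub_zero, abs_of_nonneg hD] at this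

theorem measurable_integral_attenuatedSource (hφ : IsBoundedWithin M R φ)
    (hψ : IsBoundedWithin M R ψ) {D : ℝ} (hD : 0 ≤ D) {α : Type*} [MeasurableSpace α]
    {X : α → E3} {N : α → S2} (hX : Measurable X) (hN : Measurable N) :
    Measurable fun a => ∫ r in (0 : ℝ)..D, attenuatedSource φ ψ (X a) (N a) r := by
  simp only [intervalIntegral.integral_of_le hD]
  refine (StronglyMeasurable.integral_prod_right
    (f := fun a r => attenuatedSource φ ψ (X a) (N a) r) ?_).measurable
  exact (measurable_attenuatedSource hφ hψ (hX.comp measurable_fst) (hN.comp measurable_fst)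
    measurable_snd).stronglyMeasurable

/-- Write `A(x) - A(y) = (φ(x - rn) - φ(y - rn)) E(x) + φ(y - rn) (E(x) - E(y))`. In the first term
only the primitive of the `φ` increment will be small, so the derivative is moved onto `E`; in the
second the Lipschitz bound for `exp` suffices. -/
theorem abs_integral_attenuatedSource_sub_le (hφ : IsBoundedWithin M R φ)
    (hψ : IsBoundedWithin M R ψ) (x y : E3) (n : S2) {D : ℝ} (hD : 0 ≤ D) :
    |∫ r in (0 : ℝ)..D, (attenuatedSource φ ψ x n r - attenuatedSource φ ψ y n r)| ≤
      Real.exp (M * D) * (|rayIntegral φ x n D - rayIntegral φ y n D| +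
        M * (∫ r in (0 : ℝ)..D, |rayIntegral φ x n r - rayIntegral φ y n r|) +
        M * ∫ r in (0 : ℝ)..D, |rayIntegral ψ x n r - rayIntegral ψ y n r|) := by
  have hM0 := hφ.nonneg
  set g : ℝ → ℝ := fun r => φ (x - r • (n : E3)) - φ (y - r • (n : E3)) with hg
  have hgm : Measurable g :=
    (hφ.measurable.comp (by fun_prop)).sub (hφ.measurable.comp (by fun_prop))
  have hgM : ∀ r, |g r| ≤ 2 * M := fun r =>
    (abs_sub _ _).trans (by linarith [hφ.abs_le (x - r • (n : E3)), hφ.abs_le (y - r • (n : E3))])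
  have hgint : ∀ r, ∫ t in (0 : ℝ)..r, g t = rayIntegral φ x n r - rayIntegral φ y n r := fun r =>
    intervalIntegral.integral_sub (hφ.intervalIntegrable_ray x n 0 r)
      (hφ.intervalIntegrable_ray y n 0 r)
  have h1 := abs_integral_mul_exp_primitive_le hD hgm hgM
    (p := fun t => ψ (x - t • (n : E3))) (hψ.measurable.comp (by fun_prop)) (fun _ => hψ.abs_le _)
  simp only [hgint] at h1
  have hE : ∀ z : E3, Measurable fun r => attenuation ψ z n r := fun z =>
    hψ.measurable_attenuation measurable_const measurable_const measurable_id
  have hi1 : IntervalIntegrable (fun r => g r * attenuation ψ x n r) volume 0 D := by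
    rw [intervalIntegrable_iff_integrableOn_Ioc_of_le hD]
    refine (integrable_const (2 * M * Real.exp (M * D))).mono'
      (hgm.mul (hE x)).aestronglyMeasurable ?_
    filter_upwards [ae_restrict_mem measurableSet_Ioc] with r hr
    rw [norm_mul]
    exact mul_le_mul (hgM r) (hψ.abs_attenuation_le x n (Ioc_subset_Icc_self hr)) (abs_nonneg _)
      (by positivity)
  have hΨm : Measurable fun r => rayIntegral ψ x n r - rayIntegral ψ y n r :=
    (measurable_rayIntegral hψ.measurable measurable_const measurable_const measurable_id).sub
      (measurable_rayIntegral hψ.measurable measurable_const measurable_const measurable_id)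
  have hΨi : IntervalIntegrable (fun r => |rayIntegral ψ x n r - rayIntegral ψ y n r|)
      volume 0 D := by
    rw [intervalIntegrable_iff_integrableOn_Ioc_of_le hD]
    refine (integrable_const (M * D + M * D)).mono' hΨm.abs.aestronglyMeasurable ?_
    filter_upwards [ae_restrict_mem measurableSet_Ioc] with r hr
    rw [Real.norm_eq_abs, abs_abs]
    have hMr : M * r ≤ M * D := mul_le_mul_of_nonneg_left hr.2 hM0
    exact (abs_sub _ _).trans (add_le_add
      ((abs_rayIntegral_le hψ.abs_le x n hr.1.le).trans hMr)
      ((abs_rayIntegral_le hψ.abs_le y n hr.1.le).trans hMr))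
  have hdom := hΨi.const_mul (M * Real.exp (M * D))
  have hpt : ∀ r ∈ Ioc 0 D, |φ (y - r • (n : E3)) * (attenuation ψ x n r - attenuation ψ y n r)| ≤
      M * Real.exp (M * D) * |rayIntegral ψ x n r - rayIntegral ψ y n r| := fun r hr => by
    rw [abs_mul, mul_assoc]
    exact mul_le_mul (hφ.abs_le _) (hψ.abs_attenuation_sub_le x y n (Ioc_subset_Icc_self hr))
      (abs_nonneg _) hM0
  have hi2 : IntervalIntegrable (fun r => φ (y - r • (n : E3)) *
      (attenuation ψ x n r - attenuation ψ y n r)) volume 0 D := by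
    rw [intervalIntegrable_iff_integrableOn_Ioc_of_le hD] at hdom ⊢
    refine hdom.mono' ((hφ.measurable.comp (by fun_prop)).mul
      ((hE x).sub (hE y))).aestronglyMeasurable ?_
    filter_upwards [ae_restrict_mem measurableSet_Ioc] with r hr using hpt r hr
  have h2 : |∫ r in (0 : ℝ)..D, φ (y - r • (n : E3)) *
      (attenuation ψ x n r - attenuation ψ y n r)| ≤
      ∫ r in (0 : ℝ)..D, M * Real.exp (M * D) * |rayIntegral ψ x n r - rayIntegral ψ y n r| := by
    rw [← Real.norm_eq_abs]
    exact intervalIntegral.norm_integral_le_of_norm_le hD (Eventually.of_forall hpt) hdom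
  have hsplit : ∫ r in (0 : ℝ)..D, (attenuatedSource φ ψ x n r - attenuatedSource φ ψ y n r) =
      (∫ r in (0 : ℝ)..D, g r * attenuation ψ x n r) +
        ∫ r in (0 : ℝ)..D, φ (y - r • (n : E3)) *
          (attenuation ψ x n r - attenuation ψ y n r) := by
    rw [← intervalIntegral.integral_add hi1 hi2]
    refine intervalIntegral.integral_congr fun r _ => ?_
    simp only [attenuatedSource, hg]
    ring
  rw [intervalIntegral.integral_const_mul] at h2
  rw [hsplit]
  refine (abs_add_le _ _).trans ((add_le_add h1 h2).trans_eq ?_)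
  ring

end Attenuation

theorem lintegral_lintegral_lintegral_rotate {α β γ : Type*} [MeasurableSpace α]
    [MeasurableSpace β] [MeasurableSpace γ] {μ : Measure α} {ν : Measure β} {ξ : Measure γ}
    [SFinite μ] [SFinite ν] [SFinite ξ] (G : α → β → γ → ℝ≥0∞)
    (hG : Measurable fun q : α × β × γ => G q.1 q.2.1 q.2.2) :
    ∫⁻ x, ∫⁻ n, ∫⁻ r, G x n r ∂ξ ∂ν ∂μ = ∫⁻ r, ∫⁻ x, ∫⁻ n, G x n r ∂ν ∂μ ∂ξ := by
  have h1 : ∀ x, ∫⁻ n, ∫⁻ r, G x n r ∂ξ ∂ν = ∫⁻ r, ∫⁻ n, G x n r ∂ν ∂ξ := fun x =>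
    lintegral_lintegral_swap
      (hG.comp (by fun_prop : Measurable fun q : β × γ => (x, q.1, q.2))).aemeasurable
  simp_rw [h1]
  refine lintegral_lintegral_swap (Measurable.aemeasurable ?_)
  exact Measurable.lintegral_prod_right (f := fun (q : α × γ) (n : β) => G q.1 n q.2)
    (hG.comp (by fun_prop : Measurable fun q : (α × γ) × β => (q.1.1, q.2, q.1.2)))

/-! ### Uniform `L²` moduli for the attenuated quantities. -/

section Moduli

variable {M R D : ℝ}

theorem IsBoundedWithin.measurable_enorm_rayIntegral_sub {φ : E3 → ℝ} (hφ : IsBoundedWithin M R φ)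
    (h : E3) : Measurable fun q : E3 × S2 × ℝ =>
      ‖rayIntegral φ q.1 q.2.1 q.2.2 - rayIntegral φ (q.1 + h) q.2.1 q.2.2‖ₑ :=
  ((measurable_rayIntegral hφ.measurable (by fun_prop) (by fun_prop) (by fun_prop)).sub
    (measurable_rayIntegral hφ.measurable (by fun_prop) (by fun_prop) (by fun_prop))).enorm

/-- Cauchy–Schwarz in `r` costs one factor `D`; after Tonelli, integrating the bound `w` over `(0,
D]` costs another. -/
theorem IsBoundedWithin.lintegral_sq_integral_abs_rayIntegral_sub_le {φ : E3 → ℝ}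
    (hφ : IsBoundedWithin M R φ) (hD : 0 ≤ D) (h : E3) {w : ℝ≥0∞}
    (hw : ∀ r ∈ Icc 0 D, ∫⁻ x, ∫⁻ n,
      ‖rayIntegral φ x n r - rayIntegral φ (x + h) n r‖ₑ ^ 2 ∂sphereMeasure ≤ w) :
    ∫⁻ x, ∫⁻ n, ‖∫ r in (0 : ℝ)..D, |rayIntegral φ x n r - rayIntegral φ (x + h) n r|‖ₑ ^ 2
      ∂sphereMeasure ≤ ENNReal.ofReal D ^ 2 * w := by
  have hm := hφ.measurable_enorm_rayIntegral_sub h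
  have h1 : ∀ x n, ‖∫ r in (0 : ℝ)..D, |rayIntegral φ x n r - rayIntegral φ (x + h) n r|‖ₑ ^ 2 ≤
      ENNReal.ofReal D * ∫⁻ r in Ioc 0 D,
        ‖rayIntegral φ x n r - rayIntegral φ (x + h) n r‖ₑ ^ 2 := by
    intro x n
    rw [intervalIntegral.integral_of_le hD]
    have h2 := enorm_integral_le_lintegral_enorm (μ := volume.restrict (Ioc 0 D))
      fun r => |rayIntegral φ x n r - rayIntegral φ (x + h) n r|
    simp only [Real.enorm_abs] at h2
    have h3 := ENNReal.sq_lintegral_le (μ := volume.restrict (Ioc 0 D))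
      (F := fun r => ‖rayIntegral φ x n r - rayIntegral φ (x + h) n r‖ₑ)
      (hm.comp (by fun_prop : Measurable fun r : ℝ => (x, n, r))).aemeasurable
    rw [Measure.restrict_apply_univ, Real.volume_Ioc, sub_zero] at h3
    exact (pow_le_pow_left₀ zero_le h2 2).trans h3
  calc _ ≤ ∫⁻ x, ∫⁻ n, ENNReal.ofReal D * (∫⁻ r in Ioc 0 D,
        ‖rayIntegral φ x n r - rayIntegral φ (x + h) n r‖ₑ ^ 2) ∂sphereMeasure :=
        lintegral_mono fun x => lintegral_mono fun n => h1 x n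
    _ = ENNReal.ofReal D * ∫⁻ x, ∫⁻ n, (∫⁻ r in Ioc 0 D,
        ‖rayIntegral φ x n r - rayIntegral φ (x + h) n r‖ₑ ^ 2) ∂sphereMeasure := by
        simp only [lintegral_const_mul' _ _ ENNReal.ofReal_ne_top]
    _ = ENNReal.ofReal D * ∫⁻ r in Ioc 0 D, ∫⁻ x, ∫⁻ n,
        ‖rayIntegral φ x n r - rayIntegral φ (x + h) n r‖ₑ ^ 2 ∂sphereMeasure := by
        congr 1
        exact lintegral_lintegral_lintegral_rotate (fun x n r =>
          ‖rayIntegral φ x n r - rayIntegral φ (x + h) n r‖ₑ ^ 2) (hm.pow_const 2)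
    _ ≤ ENNReal.ofReal D * ∫⁻ _ in Ioc 0 D, w := by
        gcongr 1
        exact setLIntegral_mono measurable_const fun r hr => hw r (Ioc_subset_Icc_self hr)
    _ = _ := by
        rw [setLIntegral_const, Real.volume_Ioc, sub_zero]
        ring

theorem exists_modulus_attenuatedSource (M R : ℝ) (hD : 0 ≤ D) :
    ∃ ω : E3 → ℝ≥0∞, Tendsto ω (𝓝 0) (𝓝 0) ∧ ∀ φ ψ, IsBoundedWithin M R φ →
      IsBoundedWithin M R ψ → ∀ h : E3, ‖h‖ ≤ 1 →
        ∫⁻ x, ∫⁻ n, ‖∫ r in (0 : ℝ)..D,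
          (attenuatedSource φ ψ x n r - attenuatedSource φ ψ (x + h) n r)‖ₑ ^ 2
          ∂sphereMeasure ≤ ω h := by
  obtain ⟨ω, hω, hle⟩ := exists_modulus_rayIntegral M R D
  set m := ENNReal.ofReal M with hm
  set B := ENNReal.ofReal (Real.exp (M * D)) with hB
  set d := ENNReal.ofReal D with hd
  -- `B` bounds the exponential and `9` comes from squaring a sum of three terms. The `1` belongs to
  -- the endpoint term at `r = D`, the two `m²d²` to the terms integrated over `r`, for `φ` and for
  -- `ψ`.
  set C : ℝ≥0∞ := B ^ 2 * (9 * (1 + m ^ 2 * d ^ 2 + m ^ 2 * d ^ 2)) with hC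
  have hCtop : C ≠ ∞ := by
    simp only [hC, hm, hB, hd]
    finiteness
  refine ⟨fun h => C * ω h, ?_, fun φ ψ hφ hψ h hh => ?_⟩
  · simpa using ENNReal.Tendsto.const_mul hω (Or.inr hCtop)
  have hM0 := hφ.nonneg
  set a : E3 → S2 → ℝ := fun x n => rayIntegral φ x n D - rayIntegral φ (x + h) n D with ha
  set b : (E3 → ℝ) → E3 → S2 → ℝ := fun φ x n =>
    ∫ r in (0 : ℝ)..D, |rayIntegral φ x n r - rayIntegral φ (x + h) n r| with hb
  have hpt : ∀ x n, ‖∫ r in (0 : ℝ)..D,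
      (attenuatedSource φ ψ x n r - attenuatedSource φ ψ (x + h) n r)‖ₑ ^ 2 ≤
      B ^ 2 * (9 * (‖a x n‖ₑ ^ 2 + m ^ 2 * ‖b φ x n‖ₑ ^ 2 + m ^ 2 * ‖b ψ x n‖ₑ ^ 2)) := by
    intro x n
    have hb0 : ∀ χ, 0 ≤ b χ x n := fun χ =>
      intervalIntegral.integral_nonneg hD fun _ _ => abs_nonneg _
    have h1 := abs_integral_attenuatedSource_sub_le hφ hψ x (x + h) n hD
    have h2 : ‖∫ r in (0 : ℝ)..D,
        (attenuatedSource φ ψ x n r - attenuatedSource φ ψ (x + h) n r)‖ₑ ≤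
        B * (‖a x n‖ₑ + m * ‖b φ x n‖ₑ + m * ‖b ψ x n‖ₑ) := by
      rw [← ofReal_norm, Real.norm_eq_abs]
      refine (ENNReal.ofReal_le_ofReal h1).trans_eq ?_
      rw [ENNReal.ofReal_mul (Real.exp_pos _).le, ENNReal.ofReal_add _ _, ENNReal.ofReal_add _ _,
        ENNReal.ofReal_mul hM0, ENNReal.ofReal_mul hM0, ← ofReal_norm (a x n),
        Real.enorm_of_nonneg (hb0 φ), Real.enorm_of_nonneg (hb0 ψ), Real.norm_eq_abs]
      · exact abs_nonneg _
      · exact mul_nonneg hM0 (hb0 φ)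
      · exact add_nonneg (abs_nonneg _) (mul_nonneg hM0 (hb0 φ))
      · exact mul_nonneg hM0 (hb0 ψ)
    calc _ ≤ (B * (‖a x n‖ₑ + m * ‖b φ x n‖ₑ + m * ‖b ψ x n‖ₑ)) ^ 2 := by gcongr
      _ ≤ B ^ 2 * (9 * (‖a x n‖ₑ ^ 2 + (m * ‖b φ x n‖ₑ) ^ 2 + (m * ‖b ψ x n‖ₑ) ^ 2)) := by
        rw [mul_pow]
        gcongr
        exact ENNReal.add_add_sq_le _ _ _
      _ = _ := by simp only [mul_pow]
  have ham : Measurable fun q : E3 × S2 => ‖a q.1 q.2‖ₑ ^ 2 :=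
    ((hφ.measurable_enorm_rayIntegral_sub h).comp
      (by fun_prop : Measurable fun q : E3 × S2 => (q.1, q.2, D))).pow_const 2
  have hbm : ∀ χ, IsBoundedWithin M R χ → Measurable fun q : E3 × S2 => ‖b χ q.1 q.2‖ₑ ^ 2 := by
    intro χ hχ
    refine Measurable.pow_const (Measurable.enorm ?_) 2
    simp only [hb, intervalIntegral.integral_of_le hD]
    refine (StronglyMeasurable.integral_prod_right (f := fun (q : E3 × S2) (r : ℝ) =>
      |rayIntegral χ q.1 q.2 r - rayIntegral χ (q.1 + h) q.2 r|) ?_).measurable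
    exact ((measurable_rayIntegral hχ.measurable (by fun_prop) (by fun_prop) (by fun_prop)).sub
      (measurable_rayIntegral hχ.measurable (by fun_prop) (by fun_prop)
        (by fun_prop))).abs.stronglyMeasurable
  have h0 := hle φ hφ D ⟨hD, le_rfl⟩ h hh
  have h1 := hφ.lintegral_sq_integral_abs_rayIntegral_sub_le hD h fun r hr => hle φ hφ r hr h hh
  have h2 := hψ.lintegral_sq_integral_abs_rayIntegral_sub_le hD h fun r hr => hle ψ hψ r hr h hh
  calc _ ≤ ∫⁻ x, ∫⁻ n, B ^ 2 * (9 * (‖a x n‖ₑ ^ 2 + m ^ 2 * ‖b φ x n‖ₑ ^ 2 +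
        m ^ 2 * ‖b ψ x n‖ₑ ^ 2)) ∂sphereMeasure :=
        lintegral_mono fun x => lintegral_mono fun n => hpt x n
    _ = B ^ 2 * (9 * ((∫⁻ x, ∫⁻ n, ‖a x n‖ₑ ^ 2 ∂sphereMeasure) +
        m ^ 2 * (∫⁻ x, ∫⁻ n, ‖b φ x n‖ₑ ^ 2 ∂sphereMeasure) +
        m ^ 2 * ∫⁻ x, ∫⁻ n, ‖b ψ x n‖ₑ ^ 2 ∂sphereMeasure)) := by
        have e : ∀ F : E3 × S2 → ℝ≥0∞, Measurable F →
            ∫⁻ x, ∫⁻ n, F (x, n) ∂sphereMeasure = ∫⁻ q, F q ∂(volume.prod sphereMeasure) :=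
          fun F hF => (lintegral_prod _ hF.aemeasurable).symm
        have hbφ := hbm φ hφ
        have hbψ := hbm ψ hψ
        rw [e _ ham, e _ hbφ, e _ hbψ, e (fun q => B ^ 2 * (9 * (‖a q.1 q.2‖ₑ ^ 2 +
          m ^ 2 * ‖b φ q.1 q.2‖ₑ ^ 2 + m ^ 2 * ‖b ψ q.1 q.2‖ₑ ^ 2))) (by fun_prop),
          lintegral_const_mul _ (by fun_prop), lintegral_const_mul _ (by fun_prop),
          lintegral_add_left (by fun_prop), lintegral_add_left (by fun_prop),
          lintegral_const_mul _ (by fun_prop), lintegral_const_mul _ (by fun_prop)]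
    _ ≤ B ^ 2 * (9 * (ω h + m ^ 2 * (d ^ 2 * ω h) + m ^ 2 * (d ^ 2 * ω h))) := by gcongr
    _ = C * ω h := by rw [hC]; ring

theorem exists_modulus_attenuation (M R : ℝ) (hD : 0 ≤ D) :
    ∃ ω : E3 → ℝ≥0∞, Tendsto ω (𝓝 0) (𝓝 0) ∧ ∀ ψ, IsBoundedWithin M R ψ →
      ∀ h : E3, ‖h‖ ≤ 1 →
        ∫⁻ x, ∫⁻ n, ‖attenuation ψ x n D - attenuation ψ (x + h) n D‖ₑ ^ 2
          ∂sphereMeasure ≤ ω h := by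
  obtain ⟨ω, hω, hle⟩ := exists_modulus_rayIntegral M R D
  set B := ENNReal.ofReal (Real.exp (M * D)) with hB
  have hBtop : B ^ 2 ≠ ∞ := by
    simp only [hB]
    finiteness
  refine ⟨fun h => B ^ 2 * ω h, ?_, fun ψ hψ h hh => ?_⟩
  · simpa using ENNReal.Tendsto.const_mul hω (Or.inr hBtop)
  refine le_trans ?_ (mul_le_mul_right (hle ψ hψ D ⟨hD, le_rfl⟩ h hh) (B ^ 2))
  simp only [← lintegral_const_mul' _ _ hBtop]
  refine lintegral_mono fun x => lintegral_mono fun n => ?_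
  rw [← mul_pow]
  refine pow_le_pow_left₀ zero_le ?_ 2
  rw [← ofReal_norm, ← ofReal_norm, ← ENNReal.ofReal_mul (Real.exp_pos _).le]
  exact ENNReal.ofReal_le_ofReal (hψ.abs_attenuation_sub_le x (x + h) n ⟨hD, le_rfl⟩)

end Moduli

/-! ### Ball averages and a Kolmogorov–Riesz compactness criterion. -/

/-- The normalised indicator of the ball of radius `δ`. -/
noncomputable def ballKernel (δ : ℝ) : E3 → ℝ :=
  (Metric.ball (0 : E3) δ).indicator fun _ => ((volume : Measure E3).real (Metric.ball 0 δ))⁻¹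

theorem integrable_ballKernel (δ : ℝ) : Integrable (ballKernel δ) :=
  (integrable_indicator_iff Metric.isOpen_ball.measurableSet).2
    (integrableOn_const measure_ball_lt_top.ne)

theorem ballKernel_nonneg (δ : ℝ) (y : E3) : 0 ≤ ballKernel δ y :=
  indicator_nonneg (fun _ _ => by positivity) y

theorem integral_ballKernel {δ : ℝ} (hδ : 0 < δ) : ∫ y, ballKernel δ y = 1 := by
  have h0 : (volume : Measure E3).real (Metric.ball 0 δ) ≠ 0 :=
    (ENNReal.toReal_pos (Metric.measure_ball_pos volume 0 hδ).ne' measure_ball_lt_top.ne).ne'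
  rw [ballKernel, integral_indicator Metric.isOpen_ball.measurableSet, setIntegral_const,
    smul_eq_mul, mul_inv_cancel₀ h0]

theorem measurable_ballKernel (δ : ℝ) : Measurable (ballKernel δ) :=
  measurable_const.indicator Metric.isOpen_ball.measurableSet

/-- The mean of `u` over the ball of radius `δ` about `x`. -/
noncomputable def ballMean (δ : ℝ) (u : E3 → ℝ) (x : E3) : ℝ :=
  ∫ y, ballKernel δ y * u (x + y)

section BallMean

variable {u : E3 → ℝ} {C δ : ℝ}

theorem integrable_ballKernel_mul (hu : Measurable u) (hC : ∀ x, |u x| ≤ C) (x : E3) :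
    Integrable fun y => ballKernel δ y * u (x + y) :=
  (integrable_ballKernel δ).mul_bdd (c := C) (hu.comp (by fun_prop)).aestronglyMeasurable
    (Eventually.of_forall fun _ => hC _)

theorem abs_ballMean_le (hδ : 0 < δ) (hC : ∀ x, |u x| ≤ C) (x : E3) :
    |ballMean δ u x| ≤ C := by
  have h := norm_integral_le_of_norm_le (f := fun y => ballKernel δ y * u (x + y))
    ((integrable_ballKernel δ).mul_const C)
    (Eventually.of_forall fun y => by
      rw [norm_mul, Real.norm_of_nonneg (ballKernel_nonneg δ y)]
      exact mul_le_mul_of_nonneg_left (hC _) (ballKernel_nonneg δ y))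
  rwa [integral_mul_const, integral_ballKernel hδ, one_mul] at h

/-- Here too the translation is moved onto the kernel, so for fixed `δ` the means of uniformly
bounded functions are equicontinuous. -/
theorem abs_ballMean_sub_le (hu : Measurable u) (hC : ∀ x, |u x| ≤ C) (x y : E3) :
    |ballMean δ u x - ballMean δ u y| ≤
      C * ∫ z, |ballKernel δ z - ballKernel δ (z - (y - x))| := by
  have hk := integrable_ballKernel δ
  have hshift : ballMean δ u y = ∫ z, ballKernel δ (z - (y - x)) * u (x + z) := by
    rw [ballMean, ← integral_add_right_eq_self
      (fun z => ballKernel δ (z - (y - x)) * u (x + z)) (y - x)]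
    refine integral_congr_ae (Eventually.of_forall fun z => ?_)
    simp only [add_sub_cancel_right]
    congr 2
    abel
  have h3 : Integrable fun z => ballKernel δ (z - (y - x)) * u (x + z) :=
    (hk.comp_sub_right (y - x)).mul_bdd (c := C) (hu.comp (by fun_prop)).aestronglyMeasurable
      (Eventually.of_forall fun _ => hC _)
  rw [hshift, ballMean, ← integral_sub (integrable_ballKernel_mul hu hC x) h3,
    ← integral_const_mul, ← Real.norm_eq_abs]
  refine norm_integral_le_of_norm_le ((hk.sub (hk.comp_sub_right (y - x))).abs.const_mul C)
    (Eventually.of_forall fun z => ?_)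
  rw [← sub_mul, norm_mul, mul_comm]
  exact mul_le_mul_of_nonneg_right (hC _) (abs_nonneg _)

theorem lintegral_ballKernel (hδ : 0 < δ) : ∫⁻ y, ENNReal.ofReal (ballKernel δ y) = 1 := by
  rw [← ofReal_integral_eq_lintegral_ofReal (integrable_ballKernel δ)
    (Eventually.of_forall (ballKernel_nonneg δ)), integral_ballKernel hδ, ENNReal.ofReal_one]

/-- Jensen's inequality for the probability density `ballKernel δ`. -/
theorem enorm_sub_ballMean_sq_le (hδ : 0 < δ) (hu : Measurable u) (hC : ∀ x, |u x| ≤ C) (x : E3) :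
    ‖u x - ballMean δ u x‖ₑ ^ 2 ≤
      ∫⁻ y, ENNReal.ofReal (ballKernel δ y) * ‖u x - u (x + y)‖ₑ ^ 2 := by
  have h1 : u x - ballMean δ u x = ∫ y, ballKernel δ y * (u x - u (x + y)) := by
    simp_rw [mul_sub]
    rw [integral_sub ((integrable_ballKernel δ).mul_const _) (integrable_ballKernel_mul hu hC x),
      integral_mul_const, integral_ballKernel hδ, one_mul, ballMean]
  have h2 : ‖u x - ballMean δ u x‖ₑ ≤
      ∫⁻ y, ENNReal.ofReal (ballKernel δ y) * ‖u x - u (x + y)‖ₑ := by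
    rw [h1]
    refine (enorm_integral_le_lintegral_enorm _).trans_eq (lintegral_congr fun y => ?_)
    rw [enorm_mul, Real.enorm_of_nonneg (ballKernel_nonneg δ y)]
  refine (pow_le_pow_left₀ zero_le h2 2).trans ?_
  have h3 := ENNReal.sq_lintegral_mul_le (μ := (volume : Measure E3))
    (measurable_ballKernel δ).ennreal_ofReal.aemeasurable
    (F := fun y => ‖u x - u (x + y)‖ₑ)
    (measurable_const.sub (hu.comp (by fun_prop))).enorm.aemeasurable
  rwa [lintegral_ballKernel hδ, one_mul] at h3

theorem lintegral_enorm_sub_ballMean_sq_le (hδ : 0 < δ) (hu : Measurable u)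
    (hC : ∀ x, |u x| ≤ C) {Ω : Set E3} {ε : ℝ≥0∞}
    (hε : ∀ h : E3, ‖h‖ < δ → ∫⁻ x in Ω, ‖u x - u (x + h)‖ₑ ^ 2 ≤ ε) :
    ∫⁻ x in Ω, ‖u x - ballMean δ u x‖ₑ ^ 2 ≤ ε := by
  have hm : Measurable fun q : E3 × E3 => ‖u q.1 - u (q.1 + q.2)‖ₑ ^ 2 :=
    ((hu.comp measurable_fst).sub (hu.comp (by fun_prop))).enorm.pow_const 2
  calc _ ≤ ∫⁻ x in Ω, ∫⁻ y, ENNReal.ofReal (ballKernel δ y) * ‖u x - u (x + y)‖ₑ ^ 2 :=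
        lintegral_mono fun x => enorm_sub_ballMean_sq_le hδ hu hC x
    _ = ∫⁻ y, ∫⁻ x in Ω, ENNReal.ofReal (ballKernel δ y) * ‖u x - u (x + y)‖ₑ ^ 2 :=
        lintegral_lintegral_swap
          (((measurable_ballKernel δ).ennreal_ofReal.comp measurable_snd).mul hm).aemeasurable
    _ ≤ ∫⁻ y, ENNReal.ofReal (ballKernel δ y) * ε := by
        refine lintegral_mono fun y => ?_
        rw [lintegral_const_mul' _ _ ENNReal.ofReal_ne_top]
        by_cases hy : ‖y‖ < δ
        · gcongr
          exact hε y hy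
        · simp [ballKernel, hy]
    _ = ε := by
        rw [lintegral_mul_const _ (measurable_ballKernel δ).ennreal_ofReal,
          lintegral_ballKernel hδ, one_mul]

end BallMean

/-- A bounded sequence of functions has, on a bounded set, finitely many members such that the
`δ`-means of every member are uniformly close to those of one of them. -/
theorem exists_finite_net_ballMean {u : ℕ → E3 → ℝ} {C δ η : ℝ} (hδ : 0 < δ) (hη : 0 < η)
    (hu : ∀ j, Measurable (u j)) (hC : ∀ j x, |u j x| ≤ C) {Ω : Set E3}
    (hΩ : Bornology.IsBounded Ω) :
    ∃ F : Set ℕ, F.Finite ∧ ∀ j, ∃ i ∈ F, ∀ x ∈ Ω,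
      |ballMean δ (u j) x - ballMean δ (u i) x| ≤ η := by
  have hC0 : 0 ≤ C := (abs_nonneg _).trans (hC 0 0)
  have ht := (tendsto_integral_abs_sub_translate (integrable_ballKernel δ)).const_mul C
  rw [mul_zero] at ht
  obtain ⟨τ, hτ, hτη⟩ := Metric.eventually_nhds_iff.1 (ht.eventually_lt_const
    (show (0 : ℝ) < η / 3 by positivity))
  have hequi : ∀ j x y, dist y x < τ →
      |ballMean δ (u j) x - ballMean δ (u j) y| ≤ η / 3 := fun j x y hxy =>
    (abs_ballMean_sub_le (hu j) (hC j) x y).trans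
      (hτη (y := y - x) (by rwa [dist_zero_right, ← dist_eq_norm])).le
  obtain ⟨t, htfin, htcov⟩ := Metric.totallyBounded_iff.1
    ((Metric.isCompact_of_isClosed_isBounded isClosed_closure
      hΩ.closure).totallyBounded.subset subset_closure) τ hτ
  have := htfin.fintype
  -- Arzelà–Ascoli by sampling: the values at a finite `τ`-net of `Ω` lie in the compact cube `[-C,
  -- C]^t`, and equicontinuity extends closeness from the net to `Ω` at a cost of `η / 3` on each
  -- side.
  set V : ℕ → t → ℝ := fun j p => ballMean δ (u j) p with hV
  have hVb : TotallyBounded (range V) := by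
    refine (isCompact_univ_pi fun _ : t => isCompact_Icc (a := -C) (b := C)).totallyBounded.subset
      ?_
    rintro _ ⟨j, rfl⟩ p -
    exact abs_le.1 (abs_ballMean_le hδ (hC j) p)
  obtain ⟨s, hs, hsfin, hscov⟩ := Metric.finite_approx_of_totallyBounded hVb (η / 3) (by positivity)
  obtain ⟨F, hF⟩ : ∃ F : Set ℕ, F.Finite ∧ s = V '' F := by
    obtain ⟨G, hG⟩ := subset_range_iff_exists_image_eq.1 hs
    obtain ⟨F, -, hFfin, hFs⟩ := (Set.exists_subset_image_finite_and (f := V) (s := G)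
      (p := fun x => x = s)).1 ⟨s, hG.ge, hsfin, rfl⟩
    exact ⟨F, hFfin, hFs.symm⟩
  refine ⟨F, hF.1, fun j => ?_⟩
  obtain ⟨v, hvs, hjv⟩ := mem_iUnion₂.1 (hscov (mem_range_self j))
  rw [hF.2] at hvs
  obtain ⟨i, hi, rfl⟩ := hvs
  refine ⟨i, hi, fun x hx => ?_⟩
  obtain ⟨p, hp, hxp⟩ := mem_iUnion₂.1 (htcov hx)
  have h1 := hequi j p x hxp
  have h2 := hequi i p x hxp
  have h3 : |ballMean δ (u j) p - ballMean δ (u i) p| ≤ η / 3 :=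
    (dist_le_pi_dist (V j) (V i) ⟨p, hp⟩).trans hjv.le
  rw [abs_le] at h1 h2 h3 ⊢
  constructor <;> linarith

/-- A uniformly bounded sequence whose translates are equicontinuous in `L²(Ω)` is compact in
`L²(Ω)`. -/
theorem isCompactSequenceInL2_of_equicontinuous {Ω : Set E3}
    (hΩ : Bornology.IsBounded Ω) {u : ℕ → E3 → ℝ} {C : ℝ} (hu : ∀ j, Measurable (u j))
    (hC : ∀ j x, |u j x| ≤ C)
    (hequi : ∀ ε : ℝ, 0 < ε → ∃ h₀ : ℝ, 0 < h₀ ∧ ∀ (j : ℕ) (h : E3), ‖h‖ < h₀ →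
      ∫⁻ x in Ω, ‖u j x - u j (x + h)‖ₑ ^ 2 ≤ ENNReal.ofReal ε) :
    IsCompactSequenceInL2 Ω u := by
  have : IsFiniteMeasure (volume.restrict Ω : Measure E3) :=
    ⟨by rw [Measure.restrict_apply_univ]; exact hΩ.measure_lt_top⟩
  have hmem : ∀ j, MemLp (u j) 2 (volume.restrict Ω) := fun j =>
    MemLp.of_bound (hu j).aestronglyMeasurable C (Eventually.of_forall fun x => hC j x)
  refine ⟨fun j => (hmem j).toLp (u j), fun j => (hmem j).coeFn_toLp, ?_⟩
  refine TotallyBounded.isCompact_of_isClosed (TotallyBounded.closure ?_) isClosed_closure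
  refine Metric.totallyBounded_iff.2 fun ε hε => ?_
  set m := (volume : Measure E3).real Ω with hm
  have hm0 : 0 ≤ m := measureReal_nonneg
  -- Two averaging errors and the distance of the means contribute at most `ε² / 36` each to the
  -- squared norm; with the factor `9` the total is `3ε² / 4 < ε²`. The `m + 1` in the net accuracy
  -- keeps its denominator positive when `Ω` is null.
  obtain ⟨δ, hδ, hsmall⟩ := hequi (ε ^ 2 / 36) (by positivity)
  obtain ⟨F, hFfin, hF⟩ := exists_finite_net_ballMean (δ := δ) hδ
    (show 0 < ε / (6 * (m + 1)) by positivity) hu hC hΩ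
  refine ⟨(fun j => (hmem j).toLp (u j)) '' F, hFfin.image _, ?_⟩
  rintro _ ⟨j, rfl⟩
  obtain ⟨i, hi, hij⟩ := hF j
  refine mem_iUnion₂.2 ⟨_, mem_image_of_mem _ hi, ?_⟩
  rw [Metric.mem_ball, dist_edist, Lp.edist_toLp_toLp]
  refine ENNReal.toReal_lt_of_lt_ofReal ?_
  rw [← ENNReal.pow_lt_pow_left_iff two_ne_zero]
  have h1 := lintegral_enorm_sub_ballMean_sq_le hδ (hu j) (hC j) (Ω := Ω) (hsmall j)
  have h2 := lintegral_enorm_sub_ballMean_sq_le hδ (hu i) (hC i) (Ω := Ω) (hsmall i)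
  set a : ℕ → E3 → ℝ≥0∞ := fun k x => ‖u k x - ballMean δ (u k) x‖ₑ ^ 2 with ha
  set η := ε / (6 * (m + 1)) with hη
  have hη0 : 0 ≤ η := by positivity
  have ham : ∀ k, Measurable (a k) := fun k => by
    refine (((hu k).sub ?_).enorm).pow_const 2
    refine (StronglyMeasurable.integral_prod_right
      (f := fun (x : E3) (y : E3) => ballKernel δ y * u k (x + y)) ?_).measurable
    exact (((measurable_ballKernel δ).comp measurable_snd).mul
      ((hu k).comp (by fun_prop))).stronglyMeasurable
  have hpt : ∀ x ∈ Ω, ‖(u j - u i) x‖ₑ ^ 2 ≤ 9 * (a j x + a i x + ENNReal.ofReal (η ^ 2)) := by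
    intro x hx
    have e : (u j - u i) x = (u j x - ballMean δ (u j) x) - (u i x - ballMean δ (u i) x) +
        (ballMean δ (u j) x - ballMean δ (u i) x) := by
      rw [Pi.sub_apply]; ring
    have hv : ‖ballMean δ (u j) x - ballMean δ (u i) x‖ₑ ≤ ENNReal.ofReal η := by
      rw [← ofReal_norm]
      exact ENNReal.ofReal_le_ofReal (hij x hx)
    rw [e, ENNReal.ofReal_pow hη0]
    refine (pow_le_pow_left₀ zero_le ((enorm_add_le _ _).trans
      (add_le_add enorm_sub_le hv)) 2).trans (ENNReal.add_add_sq_le _ _ _)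
  have hsq : eLpNorm (u j - u i) 2 (volume.restrict Ω) ^ 2 = ∫⁻ x in Ω, ‖(u j - u i) x‖ₑ ^ 2 := by
    have h3 := eLpNorm_nnreal_pow_eq_lintegral (f := u j - u i) (μ := volume.restrict Ω)
      (p := 2) two_ne_zero
    simpa using h3
  calc eLpNorm (u j - u i) 2 (volume.restrict Ω) ^ 2
      ≤ ∫⁻ x in Ω, 9 * (a j x + a i x + ENNReal.ofReal (η ^ 2)) := by
        rw [hsq]
        exact setLIntegral_mono (by fun_prop) hpt
    _ = 9 * ((∫⁻ x in Ω, a j x) + (∫⁻ x in Ω, a i x) + ENNReal.ofReal (η ^ 2) * volume Ω) := by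
        rw [lintegral_const_mul _ (by fun_prop), lintegral_add_left (by fun_prop),
          lintegral_add_left (by fun_prop), setLIntegral_const]
    _ ≤ ENNReal.ofReal 9 * (ENNReal.ofReal (ε ^ 2 / 36) + ENNReal.ofReal (ε ^ 2 / 36) +
        ENNReal.ofReal (η ^ 2) * ENNReal.ofReal m) := by
        rw [hm, Measure.real, ENNReal.ofReal_toReal hΩ.measure_lt_top.ne, ENNReal.ofReal_ofNat]
        gcongr
    _ = ENNReal.ofReal (9 * (ε ^ 2 / 36 + ε ^ 2 / 36 + η ^ 2 * m)) := by
        rw [ENNReal.ofReal_mul (by norm_num), ENNReal.ofReal_add (by positivity) (by positivity),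
          ENNReal.ofReal_add (by positivity) (by positivity), ENNReal.ofReal_mul (by positivity)]
    _ < ENNReal.ofReal ε ^ 2 := by
        rw [← ENNReal.ofReal_pow hε.le]
        refine (ENNReal.ofReal_lt_ofReal_iff (by positivity)).2 ?_
        have h4 : η ^ 2 * m ≤ ε ^ 2 / 36 := by
          rw [hη, div_pow, div_mul_eq_mul_div, div_le_div_iff₀ (by positivity) (by norm_num)]
          have h5 : m ≤ (m + 1) ^ 2 := by nlinarith
          nlinarith [mul_le_mul_of_nonneg_left h5 (sq_nonneg ε)]
        nlinarith [sq_pos_of_pos hε]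

/-! ### Bounded representatives and independence of their choice. -/

theorem ae_abs_le_norm_of_Lp_top {α : Type*} [MeasurableSpace α] {μ : Measure α}
    (g : Lp ℝ ∞ μ) : ∀ᵐ a ∂μ, |g a| ≤ ‖g‖ := by
  filter_upwards [ae_le_eLpNormEssSup (f := g) (μ := μ)] with a ha
  rw [← eLpNorm_exponent_top] at ha
  rw [Lp.norm_def, ← Real.norm_eq_abs, ← toReal_enorm]
  exact ENNReal.toReal_mono (Lp.eLpNorm_ne_top g) ha

/-- Values exceeding `M` occur on a null set and are reset to `0`; the bound then holds at every
point of every ray, as the one-dimensional estimates require. -/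
theorem exists_isBoundedWithin_ae_eq {Ω : Set E3} {M R : ℝ} (hΩ : IsOpen Ω)
    (hR : Ω ⊆ Metric.closedBall 0 R) (hM : 0 ≤ M) (g : LInfty Ω) (hg : ‖g‖ ≤ M) :
    ∃ φ, IsBoundedWithin M R φ ∧ ∀ᵐ y, zeroExt g y = φ y := by
  have hm : Measurable (zeroExt g) :=
    (Lp.stronglyMeasurable g).measurable.indicator hΩ.measurableSet
  refine ⟨fun y => if |zeroExt g y| ≤ M then zeroExt g y else 0,
    ⟨Measurable.ite (measurableSet_le hm.abs measurable_const) hm measurable_const, fun y => ?_,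
      fun y hy => ?_⟩, ?_⟩
  · split_ifs with h
    · exact h
    · simpa using hM
  · have : zeroExt g y = 0 := indicator_of_notMem (fun h => by
      have := hR h
      rw [mem_closedBall_zero_iff] at this
      linarith) _
    simp [this]
  · filter_upwards [(ae_restrict_iff' hΩ.measurableSet).1 (ae_abs_le_norm_of_Lp_top g)] with y hy
    rw [if_pos]
    by_cases h : y ∈ Ω
    · rw [zeroExt, indicator_of_mem h]
      exact (hy h).trans hg
    · rw [zeroExt, indicator_of_notMem h]
      simpa using hM

section Congr

variable {φ₀ ψ₀ φ ψ : E3 → ℝ}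

/-- One null set of directions serves all `r`: off it the whole ray meets the exceptional set in
length zero. -/
theorem ae_attenuation_congr (hψ : ∀ᵐ y, ψ₀ y = ψ y) (x : E3) :
    ∀ᵐ n : S2 ∂sphereMeasure, ∀ r, 0 ≤ r → attenuation ψ₀ x n r = attenuation ψ x n r := by
  filter_upwards [ae_sphere_ae_ray hψ x] with n hn r hr
  rw [attenuation, attenuation]
  congr 2
  refine intervalIntegral.integral_congr_ae ?_
  filter_upwards [hn] with l hl hlr
  rw [uIoc_of_le hr] at hlr
  exact hl hlr.1

theorem ae_attenuatedSource_congr (hφ : ∀ᵐ y, φ₀ y = φ y) (hψ : ∀ᵐ y, ψ₀ y = ψ y) (x : E3) :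
    ∀ᵐ n : S2 ∂sphereMeasure, ∀ᵐ r : ℝ, 0 < r →
      attenuatedSource φ₀ ψ₀ x n r = attenuatedSource φ ψ x n r := by
  filter_upwards [ae_sphere_ae_ray hφ x, ae_attenuation_congr hψ x] with n hn hE
  filter_upwards [hn] with r hr hr0
  rw [attenuatedSource, attenuatedSource, hr hr0, hE r hr0.le]

theorem ae_integral_attenuatedSource_congr (hφ : ∀ᵐ y, φ₀ y = φ y) (hψ : ∀ᵐ y, ψ₀ y = ψ y)
    {D : ℝ} (hD : 0 ≤ D) (x : E3) :
    ∀ᵐ n : S2 ∂sphereMeasure, ∫ r in (0 : ℝ)..D, attenuatedSource φ₀ ψ₀ x n r =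
      ∫ r in (0 : ℝ)..D, attenuatedSource φ ψ x n r := by
  filter_upwards [ae_attenuatedSource_congr hφ hψ x] with n hn
  refine intervalIntegral.integral_congr_ae ?_
  filter_upwards [hn] with r hr hrD
  rw [uIoc_of_le hD] at hrD
  exact hr hrD.1

theorem ae_integral_attenuatedSource_sub_congr (hφ : ∀ᵐ y, φ₀ y = φ y) (hψ : ∀ᵐ y, ψ₀ y = ψ y)
    {D : ℝ} (hD : 0 ≤ D) (x y : E3) :
    ∀ᵐ n : S2 ∂sphereMeasure,
      ∫ r in (0 : ℝ)..D, (attenuatedSource φ₀ ψ₀ x n r - attenuatedSource φ₀ ψ₀ y n r) =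
      ∫ r in (0 : ℝ)..D, (attenuatedSource φ ψ x n r - attenuatedSource φ ψ y n r) := by
  filter_upwards [ae_attenuatedSource_congr hφ hψ x, ae_attenuatedSource_congr hφ hψ y]
    with n hx hy
  refine intervalIntegral.integral_congr_ae ?_
  filter_upwards [hx, hy] with r hxr hyr hrD
  rw [uIoc_of_le hD] at hrD
  rw [hxr hrD.1, hyr hrD.1]

theorem interiorTerm_congr (hφ : ∀ᵐ y, φ₀ y = φ y) (hψ : ∀ᵐ y, ψ₀ y = ψ y)
    {D : ℝ} (hD : 0 ≤ D) : interiorTerm D φ₀ ψ₀ = interiorTerm D φ ψ :=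
  funext fun x => integral_congr_ae (ae_integral_attenuatedSource_congr hφ hψ hD x)

theorem boundaryTerm_congr (f : S2 → ℝ) (hψ : ∀ᵐ y, ψ₀ y = ψ y)
    {D : ℝ} (hD : 0 ≤ D) : boundaryTerm D f ψ₀ = boundaryTerm D f ψ :=
  funext fun x => integral_congr_ae ((ae_attenuation_congr hψ x).mono fun n hn => by
    simp only [hn D hD])

theorem ae_intervalIntegrable_ray {M R : ℝ} (hψ : IsBoundedWithin M R ψ)
    (h : ∀ᵐ y, ψ₀ y = ψ y) {D : ℝ} (hD : 0 ≤ D) (x : E3) :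
    ∀ᵐ n : S2 ∂sphereMeasure,
      IntervalIntegrable (fun l : ℝ => ψ₀ (x - l • (n : E3))) volume 0 D := by
  filter_upwards [ae_sphere_ae_ray h x] with n hn
  refine (hψ.intervalIntegrable_ray x n 0 D).congr_ae ?_
  rw [EventuallyEq, ae_restrict_iff' measurableSet_uIoc]
  filter_upwards [hn] with r hr hrD
  rw [uIoc_of_le hD] at hrD
  exact (hr hrD.1).symm

theorem ae_intervalIntegrable_attenuatedSource {M R : ℝ} (hφ : IsBoundedWithin M R φ)
    (hψ : IsBoundedWithin M R ψ) (hφ₀ : ∀ᵐ y, φ₀ y = φ y) (hψ₀ : ∀ᵐ y, ψ₀ y = ψ y) {D : ℝ}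
    (hD : 0 ≤ D) (x : E3) :
    ∀ᵐ n : S2 ∂sphereMeasure, IntervalIntegrable (attenuatedSource φ₀ ψ₀ x n) volume 0 D := by
  filter_upwards [ae_attenuatedSource_congr hφ₀ hψ₀ x] with n hn
  refine (intervalIntegrable_attenuatedSource hφ hψ x n hD).congr_ae ?_
  rw [EventuallyEq, ae_restrict_iff' measurableSet_uIoc]
  filter_upwards [hn] with r hr hrD
  rw [uIoc_of_le hD] at hrD
  exact (hr hrD.1).symm

end Congr

/-! ### Integration over directions: Cauchy–Schwarz, measurability and bounds. -/

theorem enorm_integral_sphere_sq_le {F : S2 → ℝ} (hF : Measurable F) :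
    ‖∫ n, F n ∂sphereMeasure‖ₑ ^ 2 ≤
      ENNReal.ofReal (4 * Real.pi) * ∫⁻ n, ‖F n‖ₑ ^ 2 ∂sphereMeasure := by
  rw [← sphereMeasure_univ]
  exact (pow_le_pow_left₀ zero_le (enorm_integral_le_lintegral_enorm F) 2).trans
    (ENNReal.sq_lintegral_le hF.enorm.aemeasurable)

theorem lintegral_ofReal_Lp_top_mul_le (f : Lp ℝ ∞ sphereMeasure) (F : S2 → ℝ≥0∞) :
    ∫⁻ n, ENNReal.ofReal (f n) * F n ∂sphereMeasure ≤
      ENNReal.ofReal ‖f‖ * ∫⁻ n, F n ∂sphereMeasure := by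
  rw [← lintegral_const_mul' _ _ ENNReal.ofReal_ne_top]
  refine lintegral_mono_ae ((ae_abs_le_norm_of_Lp_top f).mono fun n hn => ?_)
  gcongr
  exact (le_abs_self _).trans hn

/-- Cauchy–Schwarz with `f` itself as weight, whose total mass is at most `4π‖f‖`. -/
theorem enorm_integral_mul_sphere_sq_le (f : Lp ℝ ∞ sphereMeasure)
    (hf : ∀ᵐ n ∂sphereMeasure, 0 ≤ f n) {F : S2 → ℝ} (hF : Measurable F) :
    ‖∫ n, f n * F n ∂sphereMeasure‖ₑ ^ 2 ≤ ENNReal.ofReal (4 * Real.pi * ‖f‖) *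
      ∫⁻ n, ENNReal.ofReal (f n) * ‖F n‖ₑ ^ 2 ∂sphereMeasure := by
  have hfm : Measurable fun n => ENNReal.ofReal (f n) :=
    (Lp.stronglyMeasurable f).measurable.ennreal_ofReal
  have h1 : ‖∫ n, f n * F n ∂sphereMeasure‖ₑ ≤
      ∫⁻ n, ENNReal.ofReal (f n) * ‖F n‖ₑ ∂sphereMeasure := by
    refine (enorm_integral_le_lintegral_enorm _).trans_eq
      (lintegral_congr_ae (hf.mono fun n hn => ?_))
    simp only
    rw [enorm_mul, Real.enorm_of_nonneg hn]
  have h2 : ∫⁻ n, ENNReal.ofReal (f n) ∂sphereMeasure ≤ ENNReal.ofReal (4 * Real.pi * ‖f‖) := by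
    have h3 := lintegral_ofReal_Lp_top_mul_le f fun _ => 1
    simp only [mul_one, lintegral_const, one_mul, sphereMeasure_univ] at h3
    rwa [← ENNReal.ofReal_mul (norm_nonneg f), mul_comm] at h3
  refine (pow_le_pow_left₀ zero_le h1 2).trans
    ((ENNReal.sq_lintegral_mul_le hfm.aemeasurable hF.enorm.aemeasurable).trans ?_)
  gcongr

section Bounded

variable {M R D : ℝ} {φ ψ : E3 → ℝ}

theorem integrable_integral_attenuatedSource (hφ : IsBoundedWithin M R φ)
    (hψ : IsBoundedWithin M R ψ) (hD : 0 ≤ D) (x : E3) :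
    Integrable (fun n => ∫ r in (0 : ℝ)..D, attenuatedSource φ ψ x n r) sphereMeasure :=
  (integrable_const (M * Real.exp (M * D) * D)).mono'
    (measurable_integral_attenuatedSource hφ hψ hD measurable_const
      measurable_id).aestronglyMeasurable
    (Eventually.of_forall fun n => abs_integral_attenuatedSource_le hφ hψ x n hD)

theorem measurable_integral_attenuatedSource_sub (hφ : IsBoundedWithin M R φ)
    (hψ : IsBoundedWithin M R ψ) (hD : 0 ≤ D) (x y : E3) :
    Measurable fun n => ∫ r in (0 : ℝ)..D,
      (attenuatedSource φ ψ x n r - attenuatedSource φ ψ y n r) := by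
  have h : ∀ n, ∫ r in (0 : ℝ)..D, (attenuatedSource φ ψ x n r - attenuatedSource φ ψ y n r) =
      (∫ r in (0 : ℝ)..D, attenuatedSource φ ψ x n r) -
        ∫ r in (0 : ℝ)..D, attenuatedSource φ ψ y n r := fun n =>
    intervalIntegral.integral_sub (intervalIntegrable_attenuatedSource hφ hψ x n hD)
      (intervalIntegrable_attenuatedSource hφ hψ y n hD)
  simp_rw [h]
  exact (measurable_integral_attenuatedSource hφ hψ hD measurable_const measurable_id).sub
    (measurable_integral_attenuatedSource hφ hψ hD measurable_const measurable_id)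

theorem interiorTerm_sub (hφ : IsBoundedWithin M R φ) (hψ : IsBoundedWithin M R ψ) (hD : 0 ≤ D)
    (x y : E3) : interiorTerm D φ ψ x - interiorTerm D φ ψ y =
      ∫ n, (∫ r in (0 : ℝ)..D, (attenuatedSource φ ψ x n r - attenuatedSource φ ψ y n r))
        ∂sphereMeasure := by
  rw [interiorTerm, interiorTerm, ← integral_sub (integrable_integral_attenuatedSource hφ hψ hD x)
    (integrable_integral_attenuatedSource hφ hψ hD y)]
  refine integral_congr_ae (Eventually.of_forall fun n => ?_)
  exact (intervalIntegral.integral_sub (intervalIntegrable_attenuatedSource hφ hψ x n hD)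
    (intervalIntegrable_attenuatedSource hφ hψ y n hD)).symm

theorem measurable_interiorTerm (hφ : IsBoundedWithin M R φ) (hψ : IsBoundedWithin M R ψ)
    (hD : 0 ≤ D) : Measurable (interiorTerm D φ ψ) :=
  (StronglyMeasurable.integral_prod_right
    (f := fun (x : E3) (n : S2) => ∫ r in (0 : ℝ)..D, attenuatedSource φ ψ x n r)
    (measurable_integral_attenuatedSource hφ hψ hD measurable_fst
      measurable_snd).stronglyMeasurable).measurable

theorem abs_interiorTerm_le (hφ : IsBoundedWithin M R φ) (hψ : IsBoundedWithin M R ψ)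
    (hD : 0 ≤ D) (x : E3) :
    |interiorTerm D φ ψ x| ≤ M * Real.exp (M * D) * D * (4 * Real.pi) := by
  rw [← sphereMeasure_real_univ, ← Real.norm_eq_abs]
  exact norm_integral_le_of_norm_le_const
    (Eventually.of_forall fun n => abs_integral_attenuatedSource_le hφ hψ x n hD)

theorem lintegral_enorm_interiorTerm_sub_sq_le (hφ : IsBoundedWithin M R φ)
    (hψ : IsBoundedWithin M R ψ) (hD : 0 ≤ D) (Ω : Set E3) (h : E3) :
    ∫⁻ x in Ω, ‖∫ n, (∫ r in (0 : ℝ)..D,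
        (attenuatedSource φ ψ x n r - attenuatedSource φ ψ (x + h) n r)) ∂sphereMeasure‖ₑ ^ 2 ≤
      ENNReal.ofReal (4 * Real.pi) * ∫⁻ x in Ω, ∫⁻ n, ‖∫ r in (0 : ℝ)..D,
        (attenuatedSource φ ψ x n r - attenuatedSource φ ψ (x + h) n r)‖ₑ ^ 2 ∂sphereMeasure := by
  rw [← lintegral_const_mul' _ _ ENNReal.ofReal_ne_top]
  exact lintegral_mono fun x =>
    enorm_integral_sphere_sq_le (measurable_integral_attenuatedSource_sub hφ hψ hD x (x + h))

variable (f : Lp ℝ ∞ sphereMeasure)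

theorem ae_abs_mul_attenuation_le (hψ : IsBoundedWithin M R ψ) (hD : 0 ≤ D) (x : E3) :
    ∀ᵐ n ∂sphereMeasure, |f n * attenuation ψ x n D| ≤ ‖f‖ * Real.exp (M * D) := by
  filter_upwards [ae_abs_le_norm_of_Lp_top f] with n hn
  rw [abs_mul]
  exact mul_le_mul hn (hψ.abs_attenuation_le x n ⟨hD, le_rfl⟩) (abs_nonneg _) (norm_nonneg f)

theorem measurable_attenuation_direction (hψ : IsBoundedWithin M R ψ) (x : E3) :
    Measurable fun n => attenuation ψ x n D :=
  hψ.measurable_attenuation measurable_const measurable_id measurable_const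

theorem integrable_mul_attenuation (hψ : IsBoundedWithin M R ψ) (hD : 0 ≤ D) (x : E3) :
    Integrable (fun n => f n * attenuation ψ x n D) sphereMeasure :=
  (integrable_const (‖f‖ * Real.exp (M * D))).mono'
    ((Lp.stronglyMeasurable f).measurable.mul
      (measurable_attenuation_direction hψ x)).aestronglyMeasurable
    (ae_abs_mul_attenuation_le f hψ hD x)

theorem boundaryTerm_sub (hψ : IsBoundedWithin M R ψ) (hD : 0 ≤ D) (x y : E3) :
    boundaryTerm D f ψ x - boundaryTerm D f ψ y =
      ∫ n, f n * (attenuation ψ x n D - attenuation ψ y n D) ∂sphereMeasure := by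
  rw [boundaryTerm, boundaryTerm, ← integral_sub (integrable_mul_attenuation f hψ hD x)
    (integrable_mul_attenuation f hψ hD y)]
  simp only [mul_sub]

theorem measurable_boundaryTerm (hψ : IsBoundedWithin M R ψ) :
    Measurable (boundaryTerm D f ψ) :=
  (StronglyMeasurable.integral_prod_right
    (f := fun (x : E3) (n : S2) => f n * attenuation ψ x n D)
    (((Lp.stronglyMeasurable f).measurable.comp measurable_snd).mul
      (hψ.measurable_attenuation measurable_fst measurable_snd
        measurable_const)).stronglyMeasurable).measurable

theorem abs_boundaryTerm_le (hψ : IsBoundedWithin M R ψ) (hD : 0 ≤ D) (x : E3) :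
    |boundaryTerm D f ψ x| ≤ ‖f‖ * Real.exp (M * D) * (4 * Real.pi) := by
  rw [← sphereMeasure_real_univ, ← Real.norm_eq_abs]
  exact norm_integral_le_of_norm_le_const (ae_abs_mul_attenuation_le f hψ hD x)

theorem lintegral_enorm_boundaryTerm_sub_sq_le (hf : ∀ᵐ n ∂sphereMeasure, 0 ≤ f n)
    (hψ : IsBoundedWithin M R ψ) (Ω : Set E3) (h : E3) :
    ∫⁻ x in Ω, ‖∫ n, f n * (attenuation ψ x n D - attenuation ψ (x + h) n D)
        ∂sphereMeasure‖ₑ ^ 2 ≤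
      ENNReal.ofReal (4 * Real.pi * ‖f‖) * ∫⁻ x in Ω, ∫⁻ n, ENNReal.ofReal (f n) *
        ‖attenuation ψ x n D - attenuation ψ (x + h) n D‖ₑ ^ 2 ∂sphereMeasure := by
  rw [← lintegral_const_mul' _ _ ENNReal.ofReal_ne_top]
  exact lintegral_mono fun x => enorm_integral_mul_sphere_sq_le f hf
    ((measurable_attenuation_direction hψ x).sub (measurable_attenuation_direction hψ (x + h)))

end Bounded

/-! ### Assembly of the main theorem. -/

theorem exists_pos_forall_norm_lt {ω : E3 → ℝ≥0∞} (hω : Tendsto ω (𝓝 0) (𝓝 0)) {c : ℝ≥0∞}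
    (hc : c ≠ ∞) {ε : ℝ} (hε : 0 < ε) :
    ∃ h₀ : ℝ, 0 < h₀ ∧ h₀ ≤ 1 ∧ ∀ h, ‖h‖ < h₀ → c * ω h < ENNReal.ofReal ε := by
  have h1 : Tendsto (fun h => c * ω h) (𝓝 0) (𝓝 0) := by
    simpa using ENNReal.Tendsto.const_mul hω (Or.inr hc)
  obtain ⟨δ, hδ, hlt⟩ := Metric.eventually_nhds_iff.1
    (h1.eventually_lt_const (ENNReal.ofReal_pos.2 hε))
  -- The cap at `1` is needed because the moduli are valid only for `‖h‖ ≤ 1`.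
  refine ⟨min δ 1, by positivity, min_le_right _ _, fun h hh => hlt ?_⟩
  rw [dist_zero_right]
  exact hh.trans_le (min_le_left _ _)

theorem mainTheorem8
    (Ω : Set E3) (hΩ_open : IsOpen Ω) (hΩ_bdd : Bornology.IsBounded Ω)
    (hΩ_C1 : HasC1Boundary Ω) (hΩ_curv : HasStrictlyPositiveCurvature Ω)
    (φ ψ : ℕ → LInfty Ω)
    (hφ : ∃ M : ℝ, ∀ j, ‖φ j‖ ≤ M) (hψ : ∃ M : ℝ, ∀ j, ‖ψ j‖ ≤ M)
    (f : Lp ℝ ∞ sphereMeasure) (hf : ∀ᵐ n ∂sphereMeasure, 0 ≤ f n)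
    (D : ℝ) (hD : D = Metric.diam Ω) :
    -- all the integrals that occur below are well defined, at every point of space
    (∀ (j : ℕ) (x : E3),
      (∀ᵐ n : S2 ∂sphereMeasure,
        IntervalIntegrable (fun l : ℝ => zeroExt (ψ j) (x - l • (n : E3))) volume 0 D ∧
        IntervalIntegrable (attenuatedSource (zeroExt (φ j)) (zeroExt (ψ j)) x n) volume 0 D) ∧
      Integrable (fun n => ∫ r in (0 : ℝ)..D,
        attenuatedSource (zeroExt (φ j)) (zeroExt (ψ j)) x n r) sphereMeasure ∧
      Integrable (fun n => f n * attenuation (zeroExt (ψ j)) x n D) sphereMeasure) ∧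
    -- compactness in `L²(Ω)`
    IsCompactSequenceInL2 Ω (fun j => interiorTerm D (zeroExt (φ j)) (zeroExt (ψ j))) ∧
    IsCompactSequenceInL2 Ω (fun j => boundaryTerm D f (zeroExt (ψ j))) ∧
    -- equi-integrability
    (∀ ε : ℝ, 0 < ε → ∃ h₀ : ℝ, 0 < h₀ ∧ ∀ (j : ℕ) (h : E3), ‖h‖ < h₀ →
      ((∫⁻ x in Ω, ‖∫ n, (∫ r in (0 : ℝ)..D,
            (attenuatedSource (zeroExt (φ j)) (zeroExt (ψ j)) x n r -
              attenuatedSource (zeroExt (φ j)) (zeroExt (ψ j)) (x + h) n r))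
              ∂sphereMeasure‖ₑ ^ 2) ≤
          ENNReal.ofReal (4 * Real.pi) * ∫⁻ x in Ω, ∫⁻ n, ‖∫ r in (0 : ℝ)..D,
            (attenuatedSource (zeroExt (φ j)) (zeroExt (ψ j)) x n r -
              attenuatedSource (zeroExt (φ j)) (zeroExt (ψ j)) (x + h) n r)‖ₑ ^ 2
              ∂sphereMeasure ∧
        (ENNReal.ofReal (4 * Real.pi) * ∫⁻ x in Ω, ∫⁻ n, ‖∫ r in (0 : ℝ)..D,
            (attenuatedSource (zeroExt (φ j)) (zeroExt (ψ j)) x n r -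
              attenuatedSource (zeroExt (φ j)) (zeroExt (ψ j)) (x + h) n r)‖ₑ ^ 2
              ∂sphereMeasure) < ENNReal.ofReal ε) ∧
      ((∫⁻ x in Ω, ‖∫ n, f n *
            (attenuation (zeroExt (ψ j)) x n D - attenuation (zeroExt (ψ j)) (x + h) n D)
              ∂sphereMeasure‖ₑ ^ 2) ≤
          ENNReal.ofReal (4 * Real.pi * ‖f‖) * ∫⁻ x in Ω, ∫⁻ n, ENNReal.ofReal (f n) *
            ‖attenuation (zeroExt (ψ j)) x n D - attenuation (zeroExt (ψ j)) (x + h) n D‖ₑ ^ 2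
              ∂sphereMeasure ∧
        (ENNReal.ofReal (4 * Real.pi * ‖f‖) * ∫⁻ x in Ω, ∫⁻ n, ENNReal.ofReal (f n) *
            ‖attenuation (zeroExt (ψ j)) x n D - attenuation (zeroExt (ψ j)) (x + h) n D‖ₑ ^ 2
              ∂sphereMeasure) < ENNReal.ofReal ε)) := by
  have hD0 : 0 ≤ D := hD ▸ Metric.diam_nonneg
  obtain ⟨M₁, hM₁⟩ := hφ
  obtain ⟨M₂, hM₂⟩ := hψ
  obtain ⟨R, hR⟩ := hΩ_bdd.subset_closedBall 0
  set M := max M₁ M₂ with hM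
  have hM0 : 0 ≤ M := (norm_nonneg (φ 0)).trans ((hM₁ 0).trans (le_max_left _ _))
  choose φ' hφ' hφe using fun j =>
    exists_isBoundedWithin_ae_eq hΩ_open hR hM0 (φ j) ((hM₁ j).trans (le_max_left _ _))
  choose ψ' hψ' hψe using fun j =>
    exists_isBoundedWithin_ae_eq hΩ_open hR hM0 (ψ j) ((hM₂ j).trans (le_max_right _ _))
  have hint : (fun j => interiorTerm D (zeroExt (φ j)) (zeroExt (ψ j))) =
      fun j => interiorTerm D (φ' j) (ψ' j) :=
    funext fun j => interiorTerm_congr (hφe j) (hψe j) hD0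
  have hbdry : (fun j => boundaryTerm D f (zeroExt (ψ j))) = fun j => boundaryTerm D f (ψ' j) :=
    funext fun j => boundaryTerm_congr f (hψe j) hD0
  obtain ⟨ω₁, hω₁, hle₁⟩ := exists_modulus_attenuatedSource M R hD0
  obtain ⟨ω₂, hω₂, hle₂⟩ := exists_modulus_attenuation M R hD0
  have hsmall₁ : ∀ ε : ℝ, 0 < ε → ∃ h₀ : ℝ, 0 < h₀ ∧ ∀ (j : ℕ) (h : E3), ‖h‖ < h₀ →
      ENNReal.ofReal (4 * Real.pi) * ∫⁻ x in Ω, ∫⁻ n, ‖∫ r in (0 : ℝ)..D,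
        (attenuatedSource (φ' j) (ψ' j) x n r - attenuatedSource (φ' j) (ψ' j) (x + h) n r)‖ₑ ^ 2
          ∂sphereMeasure < ENNReal.ofReal ε := by
    intro ε hε
    obtain ⟨h₀, hpos, hle, hlt⟩ := exists_pos_forall_norm_lt hω₁
      (ENNReal.ofReal_ne_top (r := 4 * Real.pi)) hε
    refine ⟨h₀, hpos, fun j h hh => lt_of_le_of_lt ?_ (hlt h hh)⟩
    gcongr
    exact (setLIntegral_le_lintegral _ _).trans
      (hle₁ _ _ (hφ' j) (hψ' j) h (hh.le.trans hle))
  have hsmall₂ : ∀ ε : ℝ, 0 < ε → ∃ h₀ : ℝ, 0 < h₀ ∧ ∀ (j : ℕ) (h : E3), ‖h‖ < h₀ →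
      ENNReal.ofReal (4 * Real.pi * ‖f‖) * ∫⁻ x in Ω, ∫⁻ n, ENNReal.ofReal (f n) *
        ‖attenuation (ψ' j) x n D - attenuation (ψ' j) (x + h) n D‖ₑ ^ 2
          ∂sphereMeasure < ENNReal.ofReal ε := by
    intro ε hε
    -- The second factor `‖f‖` pays for removing the weight `f` under the integral, since `ω₂`
    -- controls the unweighted one.
    obtain ⟨h₀, hpos, hle, hlt⟩ := exists_pos_forall_norm_lt hω₂
      (ENNReal.mul_ne_top (ENNReal.ofReal_ne_top (r := 4 * Real.pi * ‖f‖))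
        (ENNReal.ofReal_ne_top (r := ‖f‖))) hε
    refine ⟨h₀, hpos, fun j h hh => lt_of_le_of_lt ?_ (hlt h hh)⟩
    rw [mul_assoc (ENNReal.ofReal _)]
    gcongr
    refine (setLIntegral_le_lintegral _ _).trans ?_
    refine le_trans ?_ (mul_le_mul_right (hle₂ _ (hψ' j) h (hh.le.trans hle)) (ENNReal.ofReal ‖f‖))
    rw [← lintegral_const_mul' _ _ ENNReal.ofReal_ne_top]
    exact lintegral_mono fun x => lintegral_ofReal_Lp_top_mul_le f _
  refine ⟨fun j x => ⟨?_, ?_, ?_⟩, ?_, ?_, ?_⟩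
  · exact (ae_intervalIntegrable_ray (hψ' j) (hψe j) hD0 x).and
      (ae_intervalIntegrable_attenuatedSource (hφ' j) (hψ' j) (hφe j) (hψe j) hD0 x)
  · refine (integrable_integral_attenuatedSource (hφ' j) (hψ' j) hD0 x).congr ?_
    filter_upwards [ae_integral_attenuatedSource_congr (hφe j) (hψe j) hD0 x] with n hn
      using hn.symm
  · refine (integrable_mul_attenuation f (hψ' j) hD0 x).congr ?_
    filter_upwards [ae_attenuation_congr (hψe j) x] with n hn
    rw [hn D hD0]
  · rw [hint]
    refine isCompactSequenceInL2_of_equicontinuous hΩ_bdd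
      (fun j => measurable_interiorTerm (hφ' j) (hψ' j) hD0)
      (fun j => abs_interiorTerm_le (hφ' j) (hψ' j) hD0) fun ε hε => ?_
    obtain ⟨h₀, hpos, hlt⟩ := hsmall₁ ε hε
    refine ⟨h₀, hpos, fun j h hh => ?_⟩
    simp only [interiorTerm_sub (hφ' j) (hψ' j) hD0]
    exact (lintegral_enorm_interiorTerm_sub_sq_le (hφ' j) (hψ' j) hD0 Ω h).trans (hlt j h hh).le
  · rw [hbdry]
    refine isCompactSequenceInL2_of_equicontinuous hΩ_bdd
      (fun j => measurable_boundaryTerm f (hψ' j))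
      (fun j => abs_boundaryTerm_le f (hψ' j) hD0) fun ε hε => ?_
    obtain ⟨h₀, hpos, hlt⟩ := hsmall₂ ε hε
    refine ⟨h₀, hpos, fun j h hh => ?_⟩
    simp only [boundaryTerm_sub f (hψ' j) hD0]
    exact (lintegral_enorm_boundaryTerm_sub_sq_le f hf (hψ' j) Ω h).trans (hlt j h hh).le
  · intro ε hε
    obtain ⟨h₁, hpos₁, hlt₁⟩ := hsmall₁ ε hε
    obtain ⟨h₂, hpos₂, hlt₂⟩ := hsmall₂ ε hε
    refine ⟨min h₁ h₂, lt_min hpos₁ hpos₂, fun j h hh => ?_⟩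
    have hs := fun x : E3 =>
      ae_integral_attenuatedSource_sub_congr (hφe j) (hψe j) hD0 x (x + h)
    have ha : ∀ x : E3, ∀ᵐ n ∂sphereMeasure,
        attenuation (zeroExt (ψ j)) x n D - attenuation (zeroExt (ψ j)) (x + h) n D =
        attenuation (ψ' j) x n D - attenuation (ψ' j) (x + h) n D := fun x => by
      filter_upwards [ae_attenuation_congr (hψe j) x, ae_attenuation_congr (hψe j) (x + h)]
        with n h1 h2
      rw [h1 D hD0, h2 D hD0]
    -- The exceptional directions form a null set for each `x`, so the integrals over `n` agree at
    -- every `x` and the statement can be rewritten for `φ'` and `ψ'`.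
    have e1 := fun x : E3 => integral_congr_ae (hs x)
    have e2 := fun x : E3 => lintegral_congr_ae ((hs x).mono fun n hn =>
      congrArg (fun t : ℝ => ‖t‖ₑ ^ 2) hn)
    have e3 := fun x : E3 => integral_congr_ae ((ha x).mono fun n hn =>
      congrArg (fun t : ℝ => f n * t) hn)
    have e4 := fun x : E3 => lintegral_congr_ae ((ha x).mono fun n hn =>
      congrArg (fun t : ℝ => ENNReal.ofReal (f n) * ‖t‖ₑ ^ 2) hn)
    simp only [e1, e2, e3, e4]
    exact ⟨⟨lintegral_enorm_interiorTerm_sub_sq_le (hφ' j) (hψ' j) hD0 Ω h,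
      hlt₁ j h (hh.trans_le (min_le_left _ _))⟩,
      lintegral_enorm_boundaryTerm_sub_sq_le f hf (hψ' j) Ω h,
      hlt₂ j h (hh.trans_le (min_le_right _ _))⟩
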